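/- Let $\mathcal O$ be a commutative unital ring, $k\in\mathbb Z$, $n\ge 0$, $l=k+n$, $d=n+1$, and let $\rho=\alpha_k+\alpha_{k+1}+\dots+\alpha_l$ be a positive root of height $n+1$ in type $\mathtt A_\infty$ (simple roots $\alpha_i$, $i\in\mathbb Z$; $(\alpha_i,\alpha_i)=2$, $(\alpha_i,\alpha_{i\pm1})=-1$, $(\alpha_i,\alpha_j)=0$ otherwise). **KLR algebra.** Fix signs $\varepsilon_{ij}\in\{\pm1\}$ for $|i-j|=1$ with $\varepsilon_{ij}\varepsilon_{ji}=-1$; put $Q_{ii}=0$, $Q_{ij}(u,v)=\varepsilon_{ij}(u-v)$ if $|i-j|=1$, and $Q_{ij}=1$ if $|i-j|>1$. Let $\langle I\rangle_\rho$ be the set of words $\boldsymbol i=i_1\dots i_d$ with $\sum_r\alpha_{i_r}=\rho$, on which $\mathfrak S_d$ acts (regularly) from the left by place permutations. Let $R_\rho$ be the unital associative $\mathcal O$-algebra with generators $1_{\boldsymbol i}$ ($\boldsymbol i\in\langle I\rangle_\rho$), $y_1,\dots,y_d$, $\psi_1,\dots,\psi_{d-1}$ and relations $1_{\boldsymbol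 i}1_{\boldsymbol j}=\delta_{\boldsymbol i,\boldsymbol j}1_{\boldsymbol i}$, $\sum_{\boldsymbol i}1_{\boldsymbol i}=1$, $y_r1_{\boldsymbol i}=1_{\boldsymbol i}y_r$, $y_ry_t=y_ty_r$, $\psi_r1_{\boldsymbol i}=1_{s_r\boldsymbol i}\psi_r$, $(y_t\psi_r-\psi_ry_{s_r(t)})1_{\boldsymbol i}=\delta_{i_r,i_{r+1}}(\delta_{t,r+1}-\delta_{t,r})1_{\boldsymbol i}$, $\psi_r^21_{\boldsymbol i}=Q_{i_r,i_{r+1}}(y_r,y_{r+1})1_{\boldsymbol i}$, $\psi_r\psi_t=\psi_t\psi_r$ for $|r-t|>1$, and $$(\psi_{r+1}\psi_r\psi_{r+1}-\psi_r\psi_{r+1}\psi_r)1_{\boldsymbol i}=\delta_{i_r,i_{r+2}}\frac{Q_{i_r,i_{r+1}}(y_{r+2},y_{r+1})-Q_{i_r,i_{r+1}}(y_r,y_{r+1})}{y_{r+2}-y_r}1_{\boldsymbol i},$$ graded by $\deg 1_{\boldsymbol i}=0$, $\deg y_r1_{\boldsymbol i}=2$, $\deg\psi_r1_{\boldsymbol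 i}=-(\alpha_{i_r},\alpha_{i_{r+1}})$. Let $R'_\rho\subseteq R_\rho$ be the subalgebra generated by all $1_{\boldsymbol i}$, $\psi_r$ and $y_r-y_{r+1}$. For $w\in\mathfrak S_d$ let $\psi_w=\psi_{r_1}\cdots\psi_{r_m}$, where $w=s_{r_1}\cdots s_{r_m}$ is a reduced expression; in $R_\rho$ this element does not depend on the choice of the reduced expression. **Skew shapes.** Let $\mathscr S_\rho$ be the set of all skew shapes $\nu\setminus\mu$ ($\mu\subseteq\nu$ Young diagrams), up to shifts along diagonals, consisting of exactly one box of each of the contents $k,k+1,\dots,l$, where the content of a box is its column minus its row. Number the boxes of $\lambda\in\mathscr S_\rho$ by $1,\dots,d$ from bottom-left to top-right. Let $\boldsymbol\sigma^\lambda=(\sigma_1,\dots,\sigma_n)\in\{\pm\}^n$, where $\sigma_r=+$ if the $r$th box is not at the end of its row, and $\sigma_r=-$ otherwise. Let $\boldsymbol i^\lambda\in\langle I\rangle_\rho$ be the word of contents of the boxes of $\lambda$ read from left to right along the rows, from the top row to the bottom row. For $1\le r\le n$ let $\mathtt{sp}_r\lambda\in\mathscr S_\rho$ be obtained from $\lambda$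 by splitting the row of the $r$th box after that box if it is not at the end of its row (so that the part of $\lambda$ after it moves up by one row relative to the rest), and by attaching the row above to the end of the row of the $r$th box otherwise. For $\lambda,\mu\in\mathscr S_\rho$ let $\psi(\lambda,\mu)=\psi_{w(\lambda,\mu)}$, where $w(\lambda,\mu)$ is the unique $w\in\mathfrak S_d$ with $w\cdot\boldsymbol i^\mu=\boldsymbol i^\lambda$. Put $e=\sum_{\lambda\in\mathscr S_\rho}1_{\boldsymbol i^\lambda}$, an idempotent of $R'_\rho$; the algebra $eR'_\rho e$ is graded by the grading of $R_\rho$. **The algebra $B_n$.** Let $B$ be the path algebra over $\mathcal O$ of the quiver with vertices $+,-$ and one arrow in each direction, i.e. the algebra with generators $e(+),e(-),b$ and relations $e(\pm)e(\mp)=0$, $e(\pm)^2=e(\pm)$, $e(+)+e(-)=1$, $e(\pm)b=be(\mp)$. Let $B_n=B^{\otimes n}$ over $\mathcal O$, $e(\boldsymbol\sigma)=e(\sigma_1)\otimes\dots\otimes e(\sigma_n)$ for $\boldsymbol\sigma\in\{\pm\}^n$, and $b_r=1\otimes\dots\otimes b\otimes\dots\otimes1$ with $b$ in position $r$; $B_n$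 is graded by $\deg e(\boldsymbol\sigma)=0$, $\deg b_r=1$. **Theorem.** There is an isomorphism of graded $\mathcal O$-algebras (homogeneous of degree $0$) $$\iota:B_n\xrightarrow{\ \sim\ }eR'_\rho e,\qquad e(\boldsymbol\sigma^\lambda)\mapsto1_{\boldsymbol i^\lambda},\qquad b_re(\boldsymbol\sigma^\lambda)\mapsto\psi(\mathtt{sp}_r\lambda,\lambda)1_{\boldsymbol i^\lambda}$$ for all $\lambda\in\mathscr S_\rho$ and $1\le r\le n$. -/

import Mathlib

open scoped TensorProduct

namespace KLRTypeA

/-! ### Graded pieces determined by the degrees of homogeneous generators -/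

/-- Let `H m` be a set of elements of the `O`-algebra `A` which are declared to be homogeneous of
degree `m`. The piece of degree `m` of the resulting grading is the `O`-span of all products of
declared elements whose degrees add up to `m`. -/
def gradedPiece (O : Type*) {A : Type*} [CommRing O] [Ring A] [Algebra O A]
    (H : ℤ → Set A) (m : ℤ) : Submodule O A :=
  Submodule.span O {x | ∃ L : List (ℤ × A), (∀ p ∈ L, p.2 ∈ H p.1) ∧
    (L.map Prod.fst).sum = m ∧ (L.map Prod.snd).prod = x}

/-! ### The algebra `B` and its tensor powers; the sign `+` is `true`, the sign `-` is `false` -/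

inductive BGen : Type
  | e (s : Bool) : BGen
  | b : BGen

open FreeAlgebra in
inductive BRel (O : Type*) [CommRing O] : FreeAlgebra O BGen → FreeAlgebra O BGen → Prop
  | orth (s : Bool) : BRel O (ι O (.e s) * ι O (.e (!s))) 0
  | idem (s : Bool) : BRel O (ι O (.e s) * ι O (.e s)) (ι O (.e s))
  | sum : BRel O (ι O (.e true) + ι O (.e false)) 1
  | comm (s : Bool) : BRel O (ι O (.e s) * ι O .b) (ι O .b * ι O (.e (!s)))

/-- The path algebra of the quiver with two vertices `+`, `-` and one arrow in each direction,
by generators `e(+), e(-), b` and relations. -/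
def B (O : Type*) [CommRing O] : Type _ := RingQuot (BRel O)

noncomputable instance (O : Type*) [CommRing O] : Ring (B O) :=
  inferInstanceAs (Ring (RingQuot (BRel O)))

noncomputable instance (O : Type*) [CommRing O] : Algebra O (B O) :=
  inferInstanceAs (Algebra O (RingQuot (BRel O)))

/-- The projection from the free algebra. -/
noncomputable def B.mk (O : Type*) [CommRing O] : FreeAlgebra O BGen →ₐ[O] B O :=
  RingQuot.mkAlgHom O (BRel O)

noncomputable def B.e (O : Type*) [CommRing O] (s : Bool) : B O :=
  B.mk O (FreeAlgebra.ι O (.e s))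

noncomputable def B.b (O : Type*) [CommRing O] : B O :=
  B.mk O (FreeAlgebra.ι O .b)

/-- `B_n = B ⊗ ⋯ ⊗ B` (`n` factors). -/
abbrev Bn (O : Type*) [CommRing O] (n : ℕ) : Type _ := ⨂[O] _ : Fin n, B O

/-- `e(σ) = e(σ_1) ⊗ ⋯ ⊗ e(σ_n)`. -/
noncomputable def Bn.e (O : Type*) [CommRing O] {n : ℕ} (σ : Fin n → Bool) : Bn O n :=
  PiTensorProduct.tprod O fun r => B.e O (σ r)

/-- `b_r = 1 ⊗ ⋯ ⊗ b ⊗ ⋯ ⊗ 1` with `b` in position `r`. -/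
noncomputable def Bn.b (O : Type*) [CommRing O] {n : ℕ} (r : Fin n) : Bn O n :=
  PiTensorProduct.tprod O fun t => if t = r then B.b O else 1

/-- The grading of `B_n` with `deg e(σ) = 0` and `deg b_r = 1`. -/
noncomputable def Bn.grade (O : Type*) [CommRing O] (n : ℕ) (m : ℤ) : Submodule O (Bn O n) :=
  gradedPiece O (fun c => {x | (c = 0 ∧ ∃ σ, x = Bn.e O σ) ∨ (c = 1 ∧ ∃ r, x = Bn.b O r)}) m

/-! ### KLR algebras of type `A_∞`: `I = ℤ`, and `Q_+ = ℤ →₀ ℕ` -/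

/-- The Cartan integer `c_{ij} = (α_i, α_j)` in type `A_∞`. -/
def cartan (i j : ℤ) : ℤ := if i = j then 2 else if |i - j| = 1 then -1 else 0

/-- The polynomial `Q_{ij}(u, v)`, evaluated at two elements of a ring. -/
def Q {A : Type*} [Ring A] (ε : ℤ → ℤ → ℤˣ) (i j : ℤ) (u v : A) : A :=
  if i = j then 0 else if cartan i j = 0 then 1 else ((ε i j : ℤ) : A) * (u - v)

/-- The quotient `(Q_{ij}(u', v) - Q_{ij}(u, v)) / (u' - u)`, which is a constant in type `A`. -/
def Qdiff {A : Type*} [Ring A] (ε : ℤ → ℤ → ℤˣ) (i j : ℤ) : A :=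
  if |i - j| = 1 then ((ε i j : ℤ) : A) else 0

theorem Qdiff_mul {A : Type*} [Ring A] (ε : ℤ → ℤ → ℤˣ) (i j : ℤ) (u u' v : A) :
    Qdiff ε i j * (u' - u) = Q ε i j u' v - Q ε i j u v := by
  unfold Qdiff Q cartan
  by_cases h : i = j
  · subst h; simp
  · by_cases h' : |i - j| = 1
    · simp [h, h', mul_sub]
    · simp [h, h']

/-- Words of length `d` and content `α` (there are none unless `d` is the height of `α`). -/
structure Word (α : ℤ →₀ ℕ) (d : ℕ) : Type where
  letter : Fin d → ℤ
  sum_single : ∑ r, Finsupp.single (letter r) 1 = α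

theorem Word.ext' {α : ℤ →₀ ℕ} {d : ℕ} {i j : Word α d} (h : ∀ r, i.letter r = j.letter r) :
    i = j := by
  obtain ⟨i, hi⟩ := i
  obtain ⟨j, hj⟩ := j
  obtain rfl : i = j := funext h
  rfl

theorem Word.sum_apply {α : ℤ →₀ ℕ} {d : ℕ} (i : Word α d) (c : ℤ) :
    ∑ r, (Finsupp.single (i.letter r) 1 : ℤ →₀ ℕ) c = α c := by
  rw [← Finsupp.finsetSum_apply, i.sum_single]

theorem Word.mem_support {α : ℤ →₀ ℕ} {d : ℕ} (i : Word α d) (r : Fin d) :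
    i.letter r ∈ α.support := by
  rw [Finsupp.mem_support_iff, ← i.sum_apply]
  have : 1 ≤ ∑ t, (Finsupp.single (i.letter t) 1 : ℤ →₀ ℕ) (i.letter r) :=
    le_trans (by simp) (Finset.single_le_sum
      (f := fun t => (Finsupp.single (i.letter t) 1 : ℤ →₀ ℕ) (i.letter r))
      (fun _ _ => Nat.zero_le _) (Finset.mem_univ r))
  omega

noncomputable instance (α : ℤ →₀ ℕ) (d : ℕ) : Fintype (Word α d) :=
  Fintype.ofInjective (β := Fin d → α.support) (fun i r => ⟨i.letter r, i.mem_support r⟩) (by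
    intro i j h
    exact Word.ext' fun r => congrArg Subtype.val (congrFun h r))

/-- The left action of the symmetric group on words by place permutations. -/
def Word.act {α : ℤ →₀ ℕ} {d : ℕ} (w : Equiv.Perm (Fin d)) (i : Word α d) : Word α d :=
  ⟨fun r => i.letter (w⁻¹ r), by
    exact (Equiv.sum_comp w⁻¹ fun r => (Finsupp.single (i.letter r) 1 : ℤ →₀ ℕ)).trans i.sum_single⟩

/-- The places `r` and `r + 1` on which the `r`-th simple transposition acts. -/
def fst {d : ℕ} (r : Fin (d - 1)) : Fin d := ⟨r, by omega⟩
def snd {d : ℕ} (r : Fin (d - 1)) : Fin d := ⟨r + 1, by omega⟩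

/-- The simple transposition `s_r = (r, r + 1)`. -/
def s {d : ℕ} (r : Fin (d - 1)) : Equiv.Perm (Fin d) := Equiv.swap (fst r) (snd r)

inductive Gen (α : ℤ →₀ ℕ) (d : ℕ) : Type
  | idem (i : Word α d) : Gen α d
  | y (r : Fin d) : Gen α d
  | psi (r : Fin (d - 1)) : Gen α d

section
variable (O : Type*) [CommRing O] {α : ℤ →₀ ℕ} {d : ℕ}

def fe (i : Word α d) : FreeAlgebra O (Gen α d) := FreeAlgebra.ι O (.idem i)
def fy (r : Fin d) : FreeAlgebra O (Gen α d) := FreeAlgebra.ι O (.y r)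
def fpsi (r : Fin (d - 1)) : FreeAlgebra O (Gen α d) := FreeAlgebra.ι O (.psi r)

end

open Classical in
/-- The defining relations of the KLR algebra. -/
inductive KLRRel (O : Type*) [CommRing O] (ε : ℤ → ℤ → ℤˣ) (α : ℤ →₀ ℕ) (d : ℕ) :
    FreeAlgebra O (Gen α d) → FreeAlgebra O (Gen α d) → Prop
  | idem_mul (i j : Word α d) :
      KLRRel O ε α d (fe O i * fe O j) (if i = j then fe O i else 0)
  | idem_sum : KLRRel O ε α d (∑ i : Word α d, fe O i) 1
  | y_idem (r : Fin d) (i : Word α d) : KLRRel O ε α d (fy O r * fe O i) (fe O i * fy O r)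
  | y_comm (r t : Fin d) : KLRRel O ε α d (fy O r * fy O t) (fy O t * fy O r)
  | psi_idem (r : Fin (d - 1)) (i : Word α d) :
      KLRRel O ε α d (fpsi O r * fe O i) (fe O (i.act (s r)) * fpsi O r)
  | y_psi (t : Fin d) (r : Fin (d - 1)) (i : Word α d) :
      KLRRel O ε α d ((fy O t * fpsi O r - fpsi O r * fy O (s r t)) * fe O i)
        ((if i.letter (fst r) = i.letter (snd r) then
          ((if t = snd r then 1 else 0) - (if t = fst r then 1 else 0)) else 0) * fe O i)
  | psi_sq (r : Fin (d - 1)) (i : Word α d) :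
      KLRRel O ε α d (fpsi O r * fpsi O r * fe O i)
        (Q ε (i.letter (fst r)) (i.letter (snd r)) (fy O (fst r)) (fy O (snd r)) * fe O i)
  | psi_comm (r t : Fin (d - 1)) (h : (r : ℕ) + 1 < t ∨ (t : ℕ) + 1 < r) :
      KLRRel O ε α d (fpsi O r * fpsi O t) (fpsi O t * fpsi O r)
  | braid (r t : Fin (d - 1)) (h : (t : ℕ) = r + 1) (i : Word α d) :
      KLRRel O ε α d
        ((fpsi O t * fpsi O r * fpsi O t - fpsi O r * fpsi O t * fpsi O r) * fe O i)
        ((if i.letter (fst r) = i.letter (snd t) then Qdiff ε (i.letter (fst r)) (i.letter (snd r)) else 0)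
          * fe O i)

/-- The KLR algebra `R_α` of type `A_∞` over `O`, for `α` of height `d`. -/
def KLR (O : Type*) [CommRing O] (ε : ℤ → ℤ → ℤˣ) (α : ℤ →₀ ℕ) (d : ℕ) : Type _ :=
  RingQuot (KLRRel O ε α d)

noncomputable instance (O : Type*) [CommRing O] (ε : ℤ → ℤ → ℤˣ) (α : ℤ →₀ ℕ) (d : ℕ) :
    Ring (KLR O ε α d) :=
  inferInstanceAs (Ring (RingQuot (KLRRel O ε α d)))

noncomputable instance (O : Type*) [CommRing O] (ε : ℤ → ℤ → ℤˣ) (α : ℤ →₀ ℕ) (d : ℕ) :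
    Algebra O (KLR O ε α d) :=
  inferInstanceAs (Algebra O (RingQuot (KLRRel O ε α d)))

namespace KLR

variable (O : Type*) [CommRing O] (ε : ℤ → ℤ → ℤˣ) {α : ℤ →₀ ℕ} {d : ℕ}

/-- The projection from the free algebra. -/
noncomputable def mk (α : ℤ →₀ ℕ) (d : ℕ) : FreeAlgebra O (Gen α d) →ₐ[O] KLR O ε α d :=
  RingQuot.mkAlgHom O (KLRRel O ε α d)

/-- The idempotent `1_i` of a word `i`. -/
noncomputable def idem (i : Word α d) : KLR O ε α d :=
  mk O ε α d (fe O i)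

noncomputable def y (r : Fin d) : KLR O ε α d :=
  mk O ε α d (fy O r)

noncomputable def psi (r : Fin (d - 1)) : KLR O ε α d :=
  mk O ε α d (fpsi O r)

open Classical in
theorem idem_mul_idem (i j : Word α d) :
    idem O ε i * idem O ε j = if i = j then idem O ε i else 0 := by
  unfold idem
  have h : mk O ε α d (fe O i * fe O j) = mk O ε α d (if i = j then fe O i else 0) :=
    RingQuot.mkAlgHom_rel O (KLRRel.idem_mul (ε := ε) i j)
  rw [← map_mul, h]
  split_ifs <;> simp

/-- The grading of `R_α`: `deg 1_i = 0`, `deg (y_r 1_i) = (α_{i_r}, α_{i_r})` and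
`deg (ψ_r 1_i) = -(α_{i_r}, α_{i_{r+1}})`. -/
noncomputable def grade (α : ℤ →₀ ℕ) (d : ℕ) (m : ℤ) : Submodule O (KLR O ε α d) :=
  gradedPiece O (fun c => {x | (∃ i, c = 0 ∧ x = idem O ε i) ∨
    (∃ i r, c = cartan (i.letter r) (i.letter r) ∧ x = y O ε r * idem O ε i) ∨
    (∃ i r, c = -cartan (i.letter (fst r)) (i.letter (snd r)) ∧ x = psi O ε r * idem O ε i)}) m

/-- The subalgebra `R'_α` of `R_α` generated by all `1_i`, `y_r - y_{r+1}` and `ψ_r`. -/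
noncomputable def R' (α : ℤ →₀ ℕ) (d : ℕ) : Subalgebra O (KLR O ε α d) :=
  Algebra.adjoin O (Set.range (idem O ε) ∪
    Set.range (fun r : Fin (d - 1) => y O ε (fst r) - y O ε (snd r)) ∪ Set.range (psi O ε))

/-- The product `ψ_{r_1} ⋯ ψ_{r_m}`. -/
noncomputable def psiList (α : ℤ →₀ ℕ) (L : List (Fin (d - 1))) : KLR O ε α d :=
  (L.map (psi O ε)).prod

end KLR

/-! ### Reduced expressions and the elements `ψ_w` -/

/-- `w = s_{r_1} ⋯ s_{r_m}` is a reduced expression. -/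
def IsReducedExpr {d : ℕ} (L : List (Fin (d - 1))) (w : Equiv.Perm (Fin d)) : Prop :=
  (L.map s).prod = w ∧ ∀ L' : List (Fin (d - 1)), (L'.map s).prod = w → L.length ≤ L'.length

theorem exists_list_prod_s {d : ℕ} (w : Equiv.Perm (Fin d)) :
    ∃ L : List (Fin (d - 1)), (L.map s).prod = w := by
  cases d with
  | zero => exact ⟨[], Subsingleton.elim _ _⟩
  | succ n =>
    have hw : w ∈ Submonoid.closure
        (Set.range fun i : Fin n => Equiv.swap i.castSucc i.succ) := by
      rw [Equiv.Perm.mclosure_swap_castSucc_succ]; trivial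
    induction hw using Submonoid.closure_induction with
    | mem x hx =>
      obtain ⟨i, rfl⟩ := hx
      exact ⟨[(i : Fin (n + 1 - 1))], by simp [s, fst, snd]; rfl⟩
    | one => exact ⟨[], rfl⟩
    | mul x y _ _ hx hy =>
      obtain ⟨L, rfl⟩ := hx
      obtain ⟨M, rfl⟩ := hy
      exact ⟨L ++ M, by simp⟩

theorem exists_isReducedExpr {d : ℕ} (w : Equiv.Perm (Fin d)) :
    ∃ L : List (Fin (d - 1)), IsReducedExpr L w := by
  classical
  have h : ∃ m, ∃ L : List (Fin (d - 1)), (L.map s).prod = w ∧ L.length = m := by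
    obtain ⟨L, hL⟩ := exists_list_prod_s w
    exact ⟨_, L, hL, rfl⟩
  obtain ⟨L, hL, hm⟩ := Nat.find_spec h
  exact ⟨L, hL, fun L' hL' => hm ▸ Nat.find_min' h ⟨L', hL', rfl⟩⟩

/-- `ψ_w`, for a choice of a reduced expression of `w`. -/
noncomputable def KLR.psiPerm (O : Type*) [CommRing O] (ε : ℤ → ℤ → ℤˣ) (α : ℤ →₀ ℕ) {d : ℕ}
    (w : Equiv.Perm (Fin d)) : KLR O ε α d :=
  KLR.psiList O ε α (exists_isReducedExpr w).choose

/-! ### Positive roots and their words -/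

/-- The positive root `ρ(k, l) = α_k + α_{k+1} + ⋯ + α_l`. -/
noncomputable def root (k l : ℤ) : ℤ →₀ ℕ := ∑ c ∈ Finset.Icc k l, Finsupp.single c 1

theorem root_apply (k l c : ℤ) : root k l c = if c ∈ Finset.Icc k l then 1 else 0 := by
  classical
  simp [root, Finsupp.finsetSum_apply, Finsupp.single_apply, Finset.sum_ite_eq']

theorem Word.injective {k l : ℤ} {d : ℕ} (i : Word (root k l) d) : Function.Injective i.letter := by
  classical
  intro r t h
  by_contra hne
  have h1 := i.sum_apply (i.letter r)
  have h2 : ∑ u ∈ {r, t}, (Finsupp.single (i.letter u) 1 : ℤ →₀ ℕ) (i.letter r)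
      ≤ ∑ u, (Finsupp.single (i.letter u) 1 : ℤ →₀ ℕ) (i.letter r) :=
    Finset.sum_le_sum_of_subset (Finset.subset_univ _)
  rw [h1, Finset.sum_pair hne, root_apply, h] at h2
  simp only [Finsupp.single_eq_same] at h2
  split_ifs at h2 <;> omega

theorem Word.exists_eq {α : ℤ →₀ ℕ} {d : ℕ} (i : Word α d) {c : ℤ} (hc : c ∈ α.support) :
    ∃ r, i.letter r = c := by
  by_contra! h
  rw [Finsupp.mem_support_iff, ← i.sum_apply] at hc
  exact hc (Finset.sum_eq_zero fun r _ => Finsupp.single_eq_of_ne (h r).symm)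

/-- The symmetric group acts regularly on the words of a positive root. -/
theorem existsUnique_act_eq {k l : ℤ} {d : ℕ} (i j : Word (root k l) d) :
    ∃! w : Equiv.Perm (Fin d), j.act w = i := by
  classical
  have h : ∀ r, ∃ t, i.letter t = j.letter r := fun r => i.exists_eq (j.mem_support r)
  choose f hf using h
  have hinj : Function.Injective f := fun r t hrt => j.injective (by rw [← hf, ← hf, hrt])
  let w : Equiv.Perm (Fin d) := Equiv.ofBijective f (Finite.injective_iff_bijective.1 hinj)
  refine ⟨w, ?_, ?_⟩
  · refine Word.ext' fun r => ?_
    change j.letter (w⁻¹ r) = i.letter r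
    rw [← hf]
    exact congrArg i.letter (w.apply_symm_apply r)
  · intro v hv
    apply Equiv.ext
    intro r
    apply i.injective
    change _ = i.letter (f r)
    rw [hf, ← hv]
    simp [Word.act]

/-! ### Skew shapes; boxes are pairs (row, column) numbered from `0`, as in `YoungDiagram` -/

/-- The content of a box. -/
def content (A : ℕ × ℕ) : ℤ := (A.2 : ℤ) - A.1

/-- The set `S` of boxes is of the form `ν \ μ` for Young diagrams `μ ⊆ ν`. -/
def IsSkew (S : Finset (ℕ × ℕ)) : Prop :=
  ∃ μ ν : YoungDiagram, μ ≤ ν ∧ S = ν.cells \ μ.cells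

theorem isSkew_iff (S : Finset (ℕ × ℕ)) :
    IsSkew S ↔ ∀ A ∈ S, ∀ C ∈ S, ∀ x, A ≤ x → x ≤ C → x ∈ S := by
  classical
  constructor
  · rintro ⟨μ, ν, -, rfl⟩ A hA C hC x hAx hxC
    rw [Finset.mem_sdiff] at hA hC ⊢
    exact ⟨ν.isLowerSet hxC hC.1, fun hx => hA.2 (μ.isLowerSet hAx hx)⟩
  · intro h
    let ν : YoungDiagram := ⟨S.biUnion Finset.Iic, by
      intro a b hba ha
      simp only [Finset.coe_biUnion, Finset.mem_coe, Finset.coe_Iic, Set.mem_iUnion,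
        Set.mem_Iic, exists_prop] at ha ⊢
      obtain ⟨c, hc, hac⟩ := ha
      exact ⟨c, hc, hba.trans hac⟩⟩
    let μ : YoungDiagram := ⟨S.biUnion Finset.Iic \ S, by
      intro a b hba ha
      simp only [Finset.coe_sdiff, Finset.coe_biUnion, Finset.mem_coe, Finset.coe_Iic,
        Set.mem_sdiff, Set.mem_iUnion, Set.mem_Iic, exists_prop] at ha ⊢
      obtain ⟨⟨c, hc, hac⟩, haS⟩ := ha
      exact ⟨⟨c, hc, hba.trans hac⟩, fun hb => haS (h b hb c hc a hba hac)⟩⟩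
    refine ⟨μ, ν, ?_, ?_⟩
    · rw [← YoungDiagram.cells_subset_iff]
      exact Finset.sdiff_subset
    · change S = S.biUnion Finset.Iic \ (S.biUnion Finset.Iic \ S)
      rw [Finset.sdiff_sdiff_eq_self]
      intro x hx
      exact Finset.mem_biUnion.2 ⟨x, hx, Finset.mem_Iic.2 le_rfl⟩

/-- A set of boxes `ν \ μ` which contains exactly one box of each of the contents
`k, k + 1, …, k + n`, and no other boxes. -/
structure SkewDiagram (k : ℤ) (n : ℕ) where
  cells : Finset (ℕ × ℕ)
  isSkew : IsSkew cells
  existsUnique_content : ∀ c ∈ Set.Icc k (k + n), ∃! A, A ∈ cells ∧ content A = c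
  content_mem : ∀ A ∈ cells, content A ∈ Set.Icc k (k + n)

/-- The shift of a box by `a` steps along its diagonal. -/
def diag (a : ℕ) (A : ℕ × ℕ) : ℕ × ℕ := (A.1 + a, A.2 + a)

theorem content_diag (a : ℕ) (A : ℕ × ℕ) : content (diag a A) = content A := by
  simp [content, diag]

theorem diag_diag (a b : ℕ) (A : ℕ × ℕ) : diag a (diag b A) = diag (b + a) A := by
  simp [diag, add_assoc]

theorem diag_injective (a : ℕ) : Function.Injective (diag a) := by
  rintro ⟨x, y⟩ ⟨x', y'⟩ h
  simpa [diag] using h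

namespace SkewDiagram

variable {k : ℤ} {n : ℕ} (S T : SkewDiagram k n)

theorem index_mem (k : ℤ) {n : ℕ} (t : Fin (n + 1)) : k + (t : ℕ) ∈ Set.Icc k (k + n) := by
  have := t.is_lt
  constructor <;> omega

/-- The boxes, numbered from bottom-left to top-right, that is, by increasing content. -/
noncomputable def box (t : Fin (n + 1)) : ℕ × ℕ :=
  (S.existsUnique_content (k + (t : ℕ)) (index_mem k t)).choose

theorem box_mem (t : Fin (n + 1)) : S.box t ∈ S.cells :=
  (S.existsUnique_content (k + (t : ℕ)) (index_mem k t)).choose_spec.1.1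

theorem content_box (t : Fin (n + 1)) : content (S.box t) = k + (t : ℕ) :=
  (S.existsUnique_content (k + (t : ℕ)) (index_mem k t)).choose_spec.1.2

theorem eq_box {A : ℕ × ℕ} {t : Fin (n + 1)} (hA : A ∈ S.cells) (h : content A = k + (t : ℕ)) :
    A = S.box t :=
  (S.existsUnique_content (k + (t : ℕ)) (index_mem k t)).choose_spec.2 A ⟨hA, h⟩

theorem exists_box {A : ℕ × ℕ} (hA : A ∈ S.cells) : ∃ t, A = S.box t := by
  obtain ⟨h1, h2⟩ := S.content_mem A hA
  refine ⟨⟨(content A - k).toNat, by omega⟩, S.eq_box hA ?_⟩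
  simp only
  omega

theorem box_injective : Function.Injective S.box := by
  intro t u h
  have h1 := S.content_box t
  have h2 := S.content_box u
  rw [h] at h1
  apply Fin.ext
  omega

theorem cells_eq : S.cells = Finset.univ.image S.box := by
  ext A
  constructor
  · intro hA
    obtain ⟨t, rfl⟩ := S.exists_box hA
    exact Finset.mem_image_of_mem _ (Finset.mem_univ _)
  · intro hA
    obtain ⟨t, -, rfl⟩ := Finset.mem_image.1 hA
    exact S.box_mem t

theorem card_cells : S.cells.card = n + 1 := by
  rw [cells_eq, Finset.card_image_of_injective _ S.box_injective, Finset.card_univ,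
    Fintype.card_fin]

/-- The next box is directly to the right or directly above. -/
theorem box_step (r : Fin n) : (S.box r.succ).1 = (S.box r.castSucc).1 ∨
    (S.box r.succ).1 + 1 = (S.box r.castSucc).1 := by
  have hconv := (isSkew_iff _).1 S.isSkew
  have h1 := S.content_box r.castSucc
  have h2 := S.content_box r.succ
  have m1 := S.box_mem r.castSucc
  have m2 := S.box_mem r.succ
  have key1 : ∀ x ∈ S.cells, content x = k + (r : ℕ) → x = S.box r.castSucc :=
    fun x hx hc => S.eq_box hx (by simpa using hc)
  have key2 : ∀ x ∈ S.cells, content x = k + (r : ℕ) + 1 → x = S.box r.succ :=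
    fun x hx hc => S.eq_box hx (by simp only [Fin.val_succ]; push_cast; omega)
  simp only [Fin.val_castSucc, Fin.val_succ] at h1 h2
  generalize S.box r.castSucc = A at *
  generalize S.box r.succ = C at *
  obtain ⟨a, b⟩ := A
  obtain ⟨a', b'⟩ := C
  simp only [content] at h1 h2 key1 key2
  push_cast at h2
  by_contra hcon
  simp only [not_or] at hcon
  rcases lt_or_ge a a' with h | h
  · have := key1 (a + 1, b + 1) (hconv _ m1 _ m2 _ ⟨by simp, by simp⟩
      ⟨by simp; omega, by simp; omega⟩) (by push_cast; omega)
    simp at this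
  · have := key2 (a' + 1, b' + 1) (hconv _ m2 _ m1 _ ⟨by simp, by simp⟩
      ⟨by simp; omega, by simp; omega⟩) (by push_cast; omega)
    simp at this

/-- The diagram with prescribed boxes, each directly to the right of or above the previous one. -/
def ofPath (f : Fin (n + 1) → ℕ × ℕ) (hc : ∀ t, content (f t) = k + (t : ℕ))
    (hs : ∀ r : Fin n, (f r.succ).1 = (f r.castSucc).1 ∨
      (f r.succ).1 + 1 = (f r.castSucc).1) : SkewDiagram k n where
  cells := Finset.univ.image f
  isSkew := by
    have hrow : Antitone fun t => (f t).1 := by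
      rw [Fin.antitone_iff_succ_le]
      intro r
      rcases hs r with h | h <;> omega
    have hcol : Monotone fun t => (f t).2 := by
      rw [Fin.monotone_iff_le_succ]
      intro r
      have h1 := hc r.castSucc
      have h2 := hc r.succ
      simp only [content, Fin.val_castSucc, Fin.val_succ] at h1 h2
      push_cast at h2
      rcases hs r with h | h <;> omega
    rw [isSkew_iff]
    intro A hA C hC x hAx hxC
    obtain ⟨t, -, rfl⟩ := Finset.mem_image.1 hA
    obtain ⟨u, -, rfl⟩ := Finset.mem_image.1 hC
    have ht := hc t
    have hu := hc u
    obtain ⟨hx1, hx2⟩ := hAx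
    obtain ⟨hx3, hx4⟩ := hxC
    have htl := t.is_lt
    have hul := u.is_lt
    simp only [content] at ht hu
    rcases le_total t u with htu | htu
    · have e1 := hrow htu
      simp only at e1
      let v : Fin (n + 1) := ⟨(content x - k).toNat, by simp only [content]; omega⟩
      have hv := hc v
      have tv : t ≤ v := by
        rw [Fin.le_def]; simp only [v, content]; omega
      have vu : v ≤ u := by
        rw [Fin.le_def] at htu ⊢; simp only [v, content]; omega
      have e2 := hrow tv
      have e3 := hrow vu
      simp only [content, v] at e2 e3 hv
      refine Finset.mem_image.2 ⟨v, Finset.mem_univ _, Prod.ext ?_ ?_⟩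
      · simp only [v, content]; omega
      · simp only [v, content]; omega
    · have e1 := hcol htu
      simp only at e1
      let v : Fin (n + 1) := ⟨(content x - k).toNat, by simp only [content]; omega⟩
      have hv := hc v
      have vt : v ≤ t := by
        rw [Fin.le_def]; simp only [v, content]; omega
      have uv : u ≤ v := by
        rw [Fin.le_def] at htu ⊢; simp only [v, content]; omega
      have e2 := hcol vt
      have e3 := hcol uv
      simp only [content, v] at e2 e3 hv
      refine Finset.mem_image.2 ⟨v, Finset.mem_univ _, Prod.ext ?_ ?_⟩
      · simp only [v, content]; omega
      · simp only [v, content]; omega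
  existsUnique_content := by
    rintro c ⟨h1, h2⟩
    have hcc := hc ⟨(c - k).toNat, by omega⟩
    refine ⟨f ⟨(c - k).toNat, by omega⟩,
      ⟨Finset.mem_image_of_mem _ (Finset.mem_univ _), by simp only at hcc; omega⟩, ?_⟩
    rintro A ⟨hA, hA'⟩
    obtain ⟨t, -, rfl⟩ := Finset.mem_image.1 hA
    rw [hc] at hA'
    congr 1
    apply Fin.ext
    simp only
    omega
  content_mem := by
    intro A hA
    obtain ⟨t, -, rfl⟩ := Finset.mem_image.1 hA
    rw [hc]
    exact index_mem k t

theorem box_ofPath (f : Fin (n + 1) → ℕ × ℕ) (hc : ∀ t, content (f t) = k + (t : ℕ)) (hs)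
    (t : Fin (n + 1)) : (ofPath f hc hs).box t = f t :=
  ((ofPath f hc hs).eq_box (Finset.mem_image_of_mem _ (Finset.mem_univ t)) (hc t)).symm

/-- Two diagrams represent the same skew shape if they differ by a shift along diagonals. -/
instance : Setoid (SkewDiagram k n) where
  r S T := ∃ a b, S.cells.image (diag a) = T.cells.image (diag b)
  iseqv := by
    refine ⟨fun S => ⟨0, 0, rfl⟩, fun ⟨a, b, h⟩ => ⟨b, a, h.symm⟩, ?_⟩
    rintro S T U ⟨a, b, h⟩ ⟨a', b', h'⟩
    refine ⟨a + a', b' + b, ?_⟩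
    have e1 := congrArg (Finset.image (diag a')) h
    have e2 := congrArg (Finset.image (diag b)) h'
    simp only [Finset.image_image] at e1 e2
    have hcomp : ∀ x y : ℕ, diag x ∘ diag y = diag (y + x) :=
      fun x y => funext fun A => diag_diag x y A
    rw [hcomp, hcomp] at e1 e2
    rw [e1, ← e2, add_comm]

theorem equiv_iff : S ≈ T ↔ ∃ a b, ∀ t, diag a (S.box t) = diag b (T.box t) := by
  change (∃ a b, S.cells.image (diag a) = T.cells.image (diag b)) ↔ _
  refine exists_congr fun a => exists_congr fun b => ⟨fun h t => ?_, fun h => ?_⟩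
  · have : diag a (S.box t) ∈ T.cells.image (diag b) := by
      rw [← h]; exact Finset.mem_image_of_mem _ (S.box_mem t)
    obtain ⟨A, hA, hA'⟩ := Finset.mem_image.1 this
    rw [← hA', T.eq_box hA]
    rw [← content_diag b, hA', content_diag, S.content_box]
  · rw [S.cells_eq, T.cells_eq, Finset.image_image, Finset.image_image]
    exact Finset.image_congr fun t _ => h t

open Classical in
/-- The signs `σ^λ`: the `r`-th sign is `+` if the `r`-th box is not at the end of its row. -/
noncomputable def sign (r : Fin n) : Bool :=
  decide (∃ A ∈ S.cells, A.1 = (S.box r.castSucc).1 ∧ (S.box r.castSucc).2 < A.2)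

theorem sign_eq_true_iff (r : Fin n) :
    S.sign r = true ↔ (S.box r.succ).1 = (S.box r.castSucc).1 := by
  have h1 := S.content_box r.castSucc
  have h2 := S.content_box r.succ
  simp only [content, Fin.val_castSucc, Fin.val_succ] at h1 h2
  push_cast at h2
  simp only [sign, decide_eq_true_eq]
  constructor
  · rintro ⟨A, hA, hrow, hcol⟩
    obtain ⟨t, rfl⟩ := S.exists_box hA
    have h3 := S.content_box t
    simp only [content] at h3
    have hle : r.succ ≤ t := by
      rw [Fin.le_def, Fin.val_succ]; omega
    have hanti : Antitone fun t => (S.box t).1 := by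
      rw [Fin.antitone_iff_succ_le]
      intro r
      rcases S.box_step r with h | h <;> omega
    have e1 := hanti hle
    have e2 := hanti (Fin.castSucc_lt_succ (i := r)).le
    simp only at e1 e2
    omega
  · intro h
    exact ⟨_, S.box_mem r.succ, h, by omega⟩

/-- The row splitting operator `sp_r` on diagrams. If the `r`-th box is not at the end of its row,
then the row is split after it: relative to each other, the boxes after the `r`-th one and the
boxes up to the `r`-th one move by one step along the diagonals, so that the former end up one row
higher. Otherwise the row above is attached to the end of the row of the `r`-th box by moving the
boxes after it one step down the diagonals. -/
noncomputable def split (r : Fin n) : SkewDiagram k n :=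
  ofPath (fun t => if S.sign r = true
      then (if t ≤ r.castSucc then diag 1 (S.box t) else S.box t)
      else (if t ≤ r.castSucc then S.box t else diag 1 (S.box t)))
    (by
      intro t
      split_ifs <;> simp [content_diag, content_box])
    (by
      intro u
      have hu := S.box_step u
      have hS' := S.sign_eq_true_iff r
      have l1 : (u.succ ≤ r.castSucc) ↔ (u : ℕ) < r := by rw [Fin.le_def]; simp
      have l2 : (u.castSucc ≤ r.castSucc) ↔ (u : ℕ) ≤ r := by rw [Fin.le_def]; simp
      have hr : (u : ℕ) = r → u = r := Fin.ext
      simp only [l1, l2]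
      by_cases hur : u = r
      · subst hur
        split_ifs <;> simp_all [diag]
      · have hur' : (u : ℕ) ≠ r := fun h => hur (hr h)
        split_ifs <;> (try simp only [diag]) <;> omega)

/-- Reading the contents of a set of `m` boxes along the rows, from the top row to the bottom row
and from left to right in each row. -/
def readWord {m : ℕ} (C : Finset (ℕ × ℕ)) (h : C.card = m) (r : Fin m) : ℤ :=
  content (ofLex ((C.map (toLex (α := ℕ × ℕ)).toEmbedding).orderEmbOfFin
    (by rw [Finset.card_map, h]) r))

theorem readWord_diag {m : ℕ} (a : ℕ) (C : Finset (ℕ × ℕ)) (h : C.card = m)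
    (h' : (C.image (diag a)).card = m) : readWord (C.image (diag a)) h' = readWord C h := by
  funext r
  unfold readWord
  rw [← content_diag a (ofLex ((C.map (toLex (α := ℕ × ℕ)).toEmbedding).orderEmbOfFin _ r))]
  congr 1
  have := Finset.orderEmbOfFin_unique
    (s := (C.image (diag a)).map (toLex (α := ℕ × ℕ)).toEmbedding)
    (h := by rw [Finset.card_map, h'])
    (f := fun r => toLex (diag a (ofLex
      ((C.map (toLex (α := ℕ × ℕ)).toEmbedding).orderEmbOfFin
        (by rw [Finset.card_map, h]) r)))) ?_ ?_
  · rw [← this]; rfl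
  · intro x
    have := Finset.orderEmbOfFin_mem (C.map (toLex (α := ℕ × ℕ)).toEmbedding)
      (by rw [Finset.card_map, h] : _ = m) x
    simp only [Finset.mem_map, Equiv.coe_toEmbedding] at this ⊢
    obtain ⟨A, hA, hA'⟩ := this
    exact ⟨diag a A, Finset.mem_image_of_mem _ hA, by rw [← hA']; rfl⟩
  · intro x y hxy
    have := ((C.map (toLex (α := ℕ × ℕ)).toEmbedding).orderEmbOfFin
      (by rw [Finset.card_map, h] : _ = m)).strictMono hxy
    rw [Prod.Lex.lt_iff] at this ⊢
    simp only [diag, ofLex_toLex]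
    omega

theorem readWord_congr {m : ℕ} {C D : Finset (ℕ × ℕ)} (hCD : C = D) (h : C.card = m)
    (h' : D.card = m) : readWord C h = readWord D h' := by
  subst hCD; rfl

/-- The word `i^λ`: the contents of the boxes in the order of the leading tableau. -/
def word : Word (root k (k + n)) (n + 1) :=
  ⟨readWord S.cells S.card_cells, by
    classical
    have e1 : ∑ r, (Finsupp.single (readWord S.cells S.card_cells r) 1 : ℤ →₀ ℕ)
        = ∑ A ∈ S.cells, Finsupp.single (content A) 1 := by
      have := Finset.map_orderEmbOfFin_univ (S.cells.map (toLex (α := ℕ × ℕ)).toEmbedding)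
        (by rw [Finset.card_map, S.card_cells] : _ = n + 1)
      have h2 : ∑ A ∈ S.cells, (Finsupp.single (content A) 1 : ℤ →₀ ℕ)
          = ∑ A ∈ S.cells.map (toLex (α := ℕ × ℕ)).toEmbedding,
            Finsupp.single (content (ofLex A)) 1 := by
        rw [Finset.sum_map]; rfl
      rw [h2, ← this, Finset.sum_map]
      rfl
    rw [e1, root]
    refine Finset.sum_nbij content ?_ ?_ ?_ ?_
    · intro A hA
      exact Finset.mem_Icc.2 (S.content_mem A hA)
    · intro A hA C hC h
      exact (S.existsUnique_content _ (S.content_mem C hC)).unique ⟨hA, h⟩ ⟨hC, rfl⟩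
    · intro c hc
      obtain ⟨A, ⟨hA, hA'⟩, -⟩ := S.existsUnique_content c (Finset.mem_Icc.1 hc)
      exact ⟨A, hA, hA'⟩
    · intro A _
      rfl⟩

theorem word_eq_of_equiv (h : S ≈ T) : S.word = T.word := by
  obtain ⟨a, b, h⟩ := h
  have c1 : (S.cells.image (diag a)).card = n + 1 := by
    rw [Finset.card_image_of_injective _ (diag_injective a), card_cells]
  have c2 : (T.cells.image (diag b)).card = n + 1 := by
    rw [Finset.card_image_of_injective _ (diag_injective b), card_cells]
  refine Word.ext' fun r => ?_
  revert r
  rw [← funext_iff]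
  change readWord S.cells S.card_cells = readWord T.cells T.card_cells
  rw [← readWord_diag a S.cells S.card_cells c1, ← readWord_diag b T.cells T.card_cells c2]
  exact readWord_congr h c1 c2

theorem sign_eq_of_equiv (h : S ≈ T) : S.sign = T.sign := by
  obtain ⟨a, b, h⟩ := (equiv_iff S T).1 h
  funext r
  rw [Bool.eq_iff_iff, sign_eq_true_iff, sign_eq_true_iff]
  have h1 := congrArg Prod.fst (h r.castSucc)
  have h2 := congrArg Prod.fst (h r.succ)
  simp only [diag] at h1 h2
  omega

theorem equiv_of_sign_eq (h : S.sign = T.sign) : S ≈ T := by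
  rw [equiv_iff]
  refine ⟨(T.box 0).1, (S.box 0).1, ?_⟩
  have main : ∀ t, (S.box t).1 + (T.box 0).1 = (T.box t).1 + (S.box 0).1 := by
    intro t
    induction t using Fin.induction with
    | zero => omega
    | succ r ih =>
      have h1 := S.box_step r
      have h2 := T.box_step r
      have h3 := S.sign_eq_true_iff r
      have h4 := T.sign_eq_true_iff r
      rw [h] at h3
      have h5 := h3.symm.trans h4
      omega
  intro t
  have h1 := S.content_box t
  have h2 := T.content_box t
  have h3 := main t
  have h4 := main 0
  simp only [content] at h1 h2
  refine Prod.ext ?_ ?_ <;> simp only [diag] <;> omega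

theorem split_equiv (r : Fin n) (h : S ≈ T) : S.split r ≈ T.split r := by
  have hs := sign_eq_of_equiv S T h
  obtain ⟨a, b, h⟩ := (equiv_iff S T).1 h
  rw [equiv_iff]
  refine ⟨a, b, fun t => ?_⟩
  rw [split, split, box_ofPath, box_ofPath, hs]
  have := h t
  split_ifs
  · rw [diag_diag, diag_diag, add_comm 1 a, add_comm 1 b, ← diag_diag, ← diag_diag, this]
  · exact this
  · exact this
  · rw [diag_diag, diag_diag, add_comm 1 a, add_comm 1 b, ← diag_diag, ← diag_diag, this]

/-- In the word of `λ`, the content of the `r`-th box stands to the left of the content of the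
next box exactly when these boxes are in the same row. -/
theorem sign_eq_true_iff_word (r : Fin n) : S.sign r = true ↔
    ∀ p q, S.word.letter p = k + (r : ℕ) → S.word.letter q = k + (r : ℕ) + 1 → p < q := by
  set E := (S.cells.map (toLex (α := ℕ × ℕ)).toEmbedding).orderEmbOfFin
    (by rw [Finset.card_map, S.card_cells] : _ = n + 1) with hE
  have hmem : ∀ p, ofLex (E p) ∈ S.cells := by
    intro p
    have := Finset.orderEmbOfFin_mem (S.cells.map (toLex (α := ℕ × ℕ)).toEmbedding)
      (by rw [Finset.card_map, S.card_cells] : _ = n + 1) p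
    obtain ⟨A, hA, hA'⟩ := Finset.mem_map.1 this
    rw [hE, ← hA']
    exact hA
  have hw : ∀ p, S.word.letter p = content (ofLex (E p)) := fun p => rfl
  have hbox1 : ∀ p, S.word.letter p = k + (r : ℕ) → ofLex (E p) = S.box r.castSucc :=
    fun p hp => S.eq_box (hmem p) (by rw [← hw, hp]; simp)
  have hbox2 : ∀ p, S.word.letter p = k + (r : ℕ) + 1 → ofLex (E p) = S.box r.succ :=
    fun p hp => S.eq_box (hmem p) (by rw [← hw, hp]; simp [add_assoc])
  have h1 := S.content_box r.castSucc
  have h2 := S.content_box r.succ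
  simp only [content, Fin.val_castSucc, Fin.val_succ] at h1 h2
  push_cast at h2
  rw [sign_eq_true_iff]
  constructor
  · intro h p q hp hq
    rw [← E.lt_iff_lt, Prod.Lex.lt_iff, hbox1 p hp, hbox2 q hq]
    omega
  · intro h
    have hr := r.is_lt
    obtain ⟨p, hp⟩ := S.word.exists_eq (c := k + (r : ℕ)) (by
      rw [Finsupp.mem_support_iff, root_apply, if_pos (Finset.mem_Icc.2 ⟨by omega, by omega⟩)]
      exact one_ne_zero)
    obtain ⟨q, hq⟩ := S.word.exists_eq (c := k + (r : ℕ) + 1) (by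
      rw [Finsupp.mem_support_iff, root_apply, if_pos (Finset.mem_Icc.2 ⟨by omega, by omega⟩)]
      exact one_ne_zero)
    have hlt := h p q hp hq
    rw [← E.lt_iff_lt, Prod.Lex.lt_iff, hbox1 p hp, hbox2 q hq] at hlt
    rcases S.box_step r with h | h <;> omega

theorem equiv_of_word_eq (h : S.word = T.word) : S ≈ T := by
  apply equiv_of_sign_eq
  funext r
  rw [Bool.eq_iff_iff, sign_eq_true_iff_word, sign_eq_true_iff_word, h]

end SkewDiagram

/-- The set `𝒮_ρ` for `ρ = ρ(k, k + n)`: all skew shapes, up to shifts along diagonals, with exactly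
one box of each of the contents `k, k + 1, …, k + n`. -/
def Shape (k : ℤ) (n : ℕ) : Type := Quotient (inferInstance : Setoid (SkewDiagram k n))

namespace Shape

variable {k : ℤ} {n : ℕ}

/-- `σ^λ`. -/
noncomputable def sign : Shape k n → Fin n → Bool :=
  Quotient.lift SkewDiagram.sign SkewDiagram.sign_eq_of_equiv

/-- `i^λ`. -/
def word : Shape k n → Word (root k (k + n)) (n + 1) :=
  Quotient.lift SkewDiagram.word SkewDiagram.word_eq_of_equiv

/-- `sp_r`. -/
noncomputable def sp (r : Fin n) : Shape k n → Shape k n :=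
  Quotient.map (fun S => S.split r) fun S T h => SkewDiagram.split_equiv S T r h

theorem sign_injective : Function.Injective (sign (k := k) (n := n)) := by
  intro S T
  induction S using Quotient.inductionOn
  induction T using Quotient.inductionOn
  exact fun h => Quotient.sound (SkewDiagram.equiv_of_sign_eq _ _ h)

theorem word_injective : Function.Injective (word (k := k) (n := n)) := by
  intro S T
  induction S using Quotient.inductionOn
  induction T using Quotient.inductionOn
  exact fun h => Quotient.sound (SkewDiagram.equiv_of_word_eq _ _ h)

noncomputable instance : Fintype (Shape k n) := Fintype.ofInjective _ sign_injective

/-- The unique permutation `w(λ, μ)` with `w(λ, μ) · i^μ = i^λ`. -/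
noncomputable def perm (S T : Shape k n) : Equiv.Perm (Fin (n + 1)) :=
  (existsUnique_act_eq S.word T.word).choose

end Shape

/-! ### The algebra `e R'_ρ e` -/

/-- The corner `e A e` of an `O`-algebra is an `O`-algebra with unit `e`. -/
noncomputable instance cornerAlgebra {O A : Type*} [CommRing O] [Ring A] [Algebra O A] {e : A}
    (he : IsIdempotentElem e) : Algebra O he.Corner where
  smul c x := ⟨c • x.1, by
    obtain ⟨a, ha⟩ := x.2
    exact ⟨c • a, by simp only [mul_smul_comm, smul_mul_assoc]; rw [← ha]⟩⟩
  algebraMap :=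
    { toFun := fun c => ⟨c • e, c • e, by
        simp only [mul_smul_comm, smul_mul_assoc, he.eq]⟩
      map_one' := Subtype.ext (one_smul O e)
      map_zero' := Subtype.ext (zero_smul O e)
      map_mul' := fun c c' => Subtype.ext (by
        change (c * c') • e = (c • e) * (c' • e)
        rw [smul_mul_smul_comm, he.eq])
      map_add' := fun c c' => Subtype.ext (add_smul c c' e) }
  commutes' c x := Subtype.ext (by
    change (c • e) * x.1 = x.1 * (c • e)
    obtain ⟨h1, h2⟩ := (Subsemigroup.mem_corner_iff he).1 x.2
    rw [smul_mul_assoc, mul_smul_comm, h1, h2])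
  smul_def' c x := Subtype.ext (by
    change c • x.1 = (c • e) * x.1
    rw [smul_mul_assoc, ((Subsemigroup.mem_corner_iff he).1 x.2).1])

section
variable (O : Type*) [CommRing O] (ε : ℤ → ℤ → ℤˣ) {k : ℤ} {n : ℕ}

/-- `1_i` as an element of `R'_ρ`. -/
noncomputable def idem' (i : Word (root k (k + n)) (n + 1)) :
    KLR.R' O ε (root k (k + n)) (n + 1) :=
  ⟨KLR.idem O ε i, Algebra.subset_adjoin (Or.inl (Or.inl ⟨i, rfl⟩))⟩

/-- `ψ(λ, μ) = ψ_{w(λ, μ)}`. -/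
noncomputable def psiShape (S T : Shape k n) : KLR O ε (root k (k + n)) (n + 1) :=
  KLR.psiPerm O ε (root k (k + n)) (S.perm T)

variable (k n)

/-- `e`, the sum of the idempotents `1_{i^λ}` over `λ ∈ 𝒮_ρ`. -/
noncomputable def e : KLR.R' O ε (root k (k + n)) (n + 1) :=
  ∑ S : Shape k n, idem' O ε S.word

theorem e_idem : IsIdempotentElem (e O ε k n) := by
  classical
  have h : ∀ S T : Shape k n, idem' O ε S.word * idem' O ε T.word
      = if S = T then idem' O ε S.word else 0 := by
    intro S T
    apply Subtype.ext
    change KLR.idem O ε S.word * KLR.idem O ε T.word = _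
    rw [KLR.idem_mul_idem]
    by_cases hST : S = T
    · simp [hST, idem']
    · rw [if_neg hST, if_neg fun h => hST (Shape.word_injective h)]; rfl
  simp only [IsIdempotentElem, e, Finset.sum_mul_sum, h]
  simp

/-- The algebra `e R'_ρ e` for `ρ = ρ(k, k + n)`. -/
abbrev eRe : Type _ := (e_idem O ε k n).Corner

/-- The inclusion of `e R'_ρ e` into `R_ρ`. -/
noncomputable def eRe.incl : eRe O ε k n →ₗ[O] KLR O ε (root k (k + n)) (n + 1) where
  toFun x := (x.1 : KLR O ε (root k (k + n)) (n + 1))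
  map_add' _ _ := rfl
  map_smul' _ _ := rfl

/-- The grading of `e R'_ρ e` induced by the grading of `R_ρ`. -/
noncomputable def eRe.grade (m : ℤ) : Submodule O (eRe O ε k n) :=
  (KLR.grade O ε (root k (k + n)) (n + 1) m).comap (eRe.incl O ε k n)

end

end KLRTypeA

namespace KLRTypeA

/-! ### Inversions and reduced expressions in the symmetric group -/

section Perm

variable {d : ℕ}

/-! In a word of content ρ every letter occurs exactly once. Hence the Kronecker deltas in the
relations vanish: dots slide freely through crossings, the braid relation is exact, and Matsumoto's
theorem makes `ψ_w` well defined. The dot on the strand coloured `k + r` is then a central element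
`x_r`. Put `z_r = ±(x_r - x_{r+1})`, with sign `ε (k+r) (k+r+1)`. A square `ψ_q² 1_i` is `z_r 1_i`
if the two letters are `k+r` and `k+r+1` in some order, and `1_i` otherwise. Therefore `R'_ρ` is
spanned by the elements `z^a ψ_w 1_i` (`R'_le_stdSpan`), and its corner by the elements `z^a ψ(λ,μ)
1_{i^μ}` (`span_cornerElem`).

To see that nothing collapses, adjoin square roots `X_{k+r}` of the `z_r`. There is a representation
of `R_ρ` on functions from words to polynomials in which a crossing of the colours `c`, `c+1` acts
with weight `X_c`, other crossings act with weight 1, and `z_r` acts as `X_{k+r}²`. In a reduced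
expression no pair of strands crosses twice, so `ψ_w 1_j` becomes a matrix unit times the product of
the `X_{k+r}` over the neighbouring pairs whose order differs in the two words (`polyRep_psiPerm`).
In `i^λ` the letter `k+r` precedes `k+r+1` exactly when `σ_r = +`. So `z^a ψ(λ,μ) 1_{i^μ}` acts as
`E_{λμ} ∏ X_{k+r}^(2a_r + [σ_r^λ ≠ σ_r^μ])`.

The algebra `B` acts on a free module of rank two, with `e(±)` as diagonal matrix units and `b` as
`X` times the swap; the tensor product of `n` such actions is indexed by sign vectors, that is, by
shapes. There `⨂ b^(2a_r + [σ_r ≠ τ_r]) e(τ_r)` acts as the same weighted matrix unit. These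
weighted matrix units are linearly independent over any `O`, so both representations are faithful
with the same image, and this gives the isomorphism (`exists_algEquiv_of_span`).

Both gradings correspond to the polynomial degree of the matrix entries. Since the representations
are faithful and the graded pieces span, each piece is the full preimage of the matrices homogeneous
of its degree (`mem_iff_homMat`). Directness of the gradings and compatibility of the isomorphism
with them both follow. -/

theorem fst_lt_snd (r : Fin (d - 1)) : fst r < snd r := by
  rw [Fin.lt_def]; simp [fst, snd]

@[simp] theorem s_fst (r : Fin (d - 1)) : s r (fst r) = snd r := Equiv.swap_apply_left _ _

@[simp] theorem s_snd (r : Fin (d - 1)) : s r (snd r) = fst r := Equiv.swap_apply_right _ _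

@[simp] theorem s_s (r : Fin (d - 1)) (a : Fin d) : s r (s r a) = a := Equiv.swap_apply_self _ _ _

@[simp] theorem s_inv (r : Fin (d - 1)) : (s r)⁻¹ = s r := Equiv.swap_inv _ _

@[simp] theorem s_mul_s (r : Fin (d - 1)) : s r * s r = 1 := Equiv.swap_mul_self _ _

@[simp] theorem s_mul_s_mul (r : Fin (d - 1)) (w : Equiv.Perm (Fin d)) : s r * (s r * w) = w := by
  rw [← mul_assoc, s_mul_s, one_mul]

theorem s_apply_of_ne {r : Fin (d - 1)} {a : Fin d} (h1 : a ≠ fst r) (h2 : a ≠ snd r) :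
    s r a = a :=
  Equiv.swap_apply_of_ne_of_ne h1 h2

/-- A simple transposition preserves the order of all pairs but one. -/
theorem s_lt_s_iff {r : Fin (d - 1)} {a b : Fin d} (h : ¬(a = fst r ∧ b = snd r))
    (h' : ¬(a = snd r ∧ b = fst r)) : s r a < s r b ↔ a < b := by
  simp only [s, Equiv.swap_apply_def, fst, snd, Fin.ext_iff, Fin.lt_def] at *
  split_ifs <;> simp only at * <;> omega

/-- The set of inversions of `w⁻¹`. -/
def inversions (w : Equiv.Perm (Fin d)) : Finset (Fin d × Fin d) :=
  Finset.univ.filter fun p => p.1 < p.2 ∧ w⁻¹ p.2 < w⁻¹ p.1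

/-- The number of inversions. -/
def inv (w : Equiv.Perm (Fin d)) : ℕ := (inversions w).card

theorem mem_inversions {w : Equiv.Perm (Fin d)} {p : Fin d × Fin d} :
    p ∈ inversions w ↔ p.1 < p.2 ∧ w⁻¹ p.2 < w⁻¹ p.1 := by
  simp [inversions]

theorem inv_one : inv (1 : Equiv.Perm (Fin d)) = 0 := by
  rw [inv, Finset.card_eq_zero, Finset.eq_empty_iff_forall_notMem]
  intro p hp
  rw [mem_inversions] at hp
  exact absurd hp.1 (not_lt.2 hp.2.le)

/-- Applying `s_r` to both entries carries the old inversions to new ones, because `s_r` preserves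
the order of every pair except the two adjacent places; that pair is the single inversion gained. -/
theorem inv_s_mul {w : Equiv.Perm (Fin d)} {r : Fin (d - 1)}
    (h : w⁻¹ (fst r) < w⁻¹ (snd r)) : inv (s r * w) = inv w + 1 := by
  have hinj : Function.Injective (Prod.map (s r) (s r)) :=
    (s r).injective.prodMap (s r).injective
  have hnot : (fst r, snd r) ∉ (inversions w).image (Prod.map (s r) (s r)) := by
    intro hm
    obtain ⟨⟨a, b⟩, hp, he⟩ := Finset.mem_image.1 hm
    simp only [Prod.map, Prod.mk.injEq] at he
    rw [mem_inversions] at hp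
    have ha : a = snd r := by rw [← s_s r a, he.1, s_fst]
    have hb : b = fst r := by rw [← s_s r b, he.2, s_snd]
    subst ha hb
    exact absurd hp.1 (not_lt.2 (fst_lt_snd r).le)
  have heq : inversions (s r * w) =
      insert (fst r, snd r) ((inversions w).image (Prod.map (s r) (s r))) := by
    ext ⟨a, b⟩
    rw [mem_inversions, Finset.mem_insert]
    simp only [mul_inv_rev, s_inv, Equiv.Perm.mul_apply, Prod.mk.injEq]
    by_cases h1 : a = fst r ∧ b = snd r
    · obtain ⟨rfl, rfl⟩ := h1
      simpa [fst_lt_snd] using h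
    · have key : (a, b) ∈ (inversions w).image (Prod.map (s r) (s r)) ↔
          (s r a, s r b) ∈ inversions w := by
        rw [← hinj.mem_finset_image (s := inversions w)]
        simp
      rw [key, mem_inversions]
      simp only [h1, false_or]
      by_cases h2 : a = snd r ∧ b = fst r
      · obtain ⟨rfl, rfl⟩ := h2
        simp only [s_fst, s_snd, fst_lt_snd, true_and]
        exact ⟨fun h' => absurd h'.1 (not_lt.2 (fst_lt_snd r).le),
          fun h' => absurd h (not_lt.2 h'.le)⟩
      · rw [s_lt_s_iff h1 h2]
  rw [inv, heq, Finset.card_insert_of_notMem hnot, Finset.card_image_of_injective _ hinj, inv]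

theorem inv_s_mul' {w : Equiv.Perm (Fin d)} {r : Fin (d - 1)}
    (h : w⁻¹ (snd r) < w⁻¹ (fst r)) : inv (s r * w) + 1 = inv w := by
  have := inv_s_mul (w := s r * w) (r := r) (by simpa using h)
  rw [← this, s_mul_s_mul]

theorem lt_or_gt_of_perm (w : Equiv.Perm (Fin d)) (r : Fin (d - 1)) :
    w⁻¹ (fst r) < w⁻¹ (snd r) ∨ w⁻¹ (snd r) < w⁻¹ (fst r) :=
  lt_or_gt_of_ne fun h => (fst_lt_snd r).ne (w⁻¹.injective h)

/-- Without descents `w⁻¹` is strictly increasing, and a finite chain has no order automorphism but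
the identity. -/
theorem exists_descent {w : Equiv.Perm (Fin d)} (hw : w ≠ 1) :
    ∃ r : Fin (d - 1), w⁻¹ (snd r) < w⁻¹ (fst r) := by
  by_contra! h
  apply hw
  have hmono : StrictMono (w⁻¹ : Equiv.Perm (Fin d)) := by
    cases d with
    | zero => exact fun a => a.elim0
    | succ n =>
      rw [Fin.strictMono_iff_lt_succ]
      intro i
      exact lt_of_le_of_ne (h i) fun he => (fst_lt_snd (d := n + 1) i).ne (w⁻¹.injective he)
  have : hmono.orderIsoOfSurjective _ w⁻¹.surjective = OrderIso.refl (Fin d) :=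
    Subsingleton.elim _ _
  rw [← inv_eq_one]
  ext1 a
  exact congrArg (fun f : Fin d ≃o Fin d => f a) this

/-- Induction along the left weak order. -/
theorem perm_induction {P : Equiv.Perm (Fin d) → Prop} (one : P 1)
    (step : ∀ (r : Fin (d - 1)) (w : Equiv.Perm (Fin d)), w⁻¹ (fst r) < w⁻¹ (snd r) → P w →
      P (s r * w)) (w : Equiv.Perm (Fin d)) : P w := by
  induction hm : inv w using Nat.strong_induction_on generalizing w with
  | _ m ih =>
    by_cases hw : w = 1
    · rwa [hw]
    · obtain ⟨r, hr⟩ := exists_descent hw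
      have h1 := inv_s_mul' hr
      rw [← s_mul_s_mul r w]
      exact step r _ (by simpa using hr) (ih _ (by omega) _ rfl)

theorem inv_le_length (L : List (Fin (d - 1))) : inv (L.map s).prod ≤ L.length := by
  induction L with
  | nil => simp [inv_one]
  | cons r L ih =>
    rw [List.map_cons, List.prod_cons, List.length_cons]
    rcases lt_or_gt_of_perm (L.map s).prod r with h | h
    · rw [inv_s_mul h]; omega
    · have := inv_s_mul' h; omega

theorem exists_list_length_eq_inv (w : Equiv.Perm (Fin d)) :
    ∃ L : List (Fin (d - 1)), (L.map s).prod = w ∧ L.length = inv w := by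
  induction w using perm_induction with
  | one => exact ⟨[], rfl, inv_one.symm⟩
  | step r w h ih =>
    obtain ⟨L, rfl, hL⟩ := ih
    exact ⟨r :: L, by simp, by rw [inv_s_mul h, List.length_cons, hL]⟩

/-- One multiplication changes the number of inversions by one, so that number bounds every
expression from below, and climbing the weak order attains it. Reducedness thus becomes a count that
can be followed letter by letter. -/
theorem isReducedExpr_iff {L : List (Fin (d - 1))} {w : Equiv.Perm (Fin d)} :
    IsReducedExpr L w ↔ (L.map s).prod = w ∧ L.length = inv w := by
  refine and_congr_right fun h => ⟨fun hmin => ?_, fun hl L' hL' => ?_⟩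
  · obtain ⟨K, hK, hl⟩ := exists_list_length_eq_inv w
    have h1 := inv_le_length L
    have h2 := hmin K hK
    rw [h] at h1
    omega
  · rw [hl, ← hL']
    exact inv_le_length L'

theorem IsReducedExpr.cons {L : List (Fin (d - 1))} {w : Equiv.Perm (Fin d)}
    (hL : IsReducedExpr L w) {r : Fin (d - 1)} (h : w⁻¹ (fst r) < w⁻¹ (snd r)) :
    IsReducedExpr (r :: L) (s r * w) := by
  rw [isReducedExpr_iff] at hL ⊢
  rw [inv_s_mul h]
  simp [hL.1, hL.2]

theorem IsReducedExpr.of_cons {L : List (Fin (d - 1))} {w : Equiv.Perm (Fin d)}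
    {r : Fin (d - 1)} (hL : IsReducedExpr (r :: L) w) :
    w⁻¹ (snd r) < w⁻¹ (fst r) ∧ IsReducedExpr L (s r * w) := by
  rw [isReducedExpr_iff] at hL ⊢
  obtain ⟨h1, h2⟩ := hL
  rw [List.map_cons, List.prod_cons] at h1
  rw [List.length_cons] at h2
  have h3 : (L.map s).prod = s r * w := by rw [← h1, s_mul_s_mul]
  have h4 := inv_le_length L
  rw [h3] at h4
  rcases lt_or_gt_of_perm w r with h | h
  · have := inv_s_mul h; omega
  · have := inv_s_mul' h
    exact ⟨h, h3, by omega⟩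

theorem s_mul_comm {r t : Fin (d - 1)} (h : (r : ℕ) + 1 < t ∨ (t : ℕ) + 1 < r) :
    s r * s t = s t * s r := by
  apply Equiv.Perm.Disjoint.commute
  intro a
  by_contra! hc
  have h1 : a = fst r ∨ a = snd r := by
    by_contra! hh; exact hc.1 (s_apply_of_ne hh.1 hh.2)
  have h2 : a = fst t ∨ a = snd t := by
    by_contra! hh; exact hc.2 (s_apply_of_ne hh.1 hh.2)
  simp only [fst, snd, Fin.ext_iff] at h1 h2
  omega

theorem s_braid {r t : Fin (d - 1)} (h : (t : ℕ) = r + 1) :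
    s t * s r * s t = s r * s t * s r := by
  have h1 : fst t = snd r := Fin.ext (by simp [fst, snd, h])
  have h2 : fst r ≠ snd r := (fst_lt_snd r).ne
  have h3 : snd t ≠ snd r := by simp [snd, Fin.ext_iff, h]
  have h4 : snd t ≠ fst r := by simp [fst, snd, Fin.ext_iff, h]; omega
  unfold s
  rw [h1, Equiv.swap_mul_swap_mul_swap h2 h4.symm, Equiv.swap_comm (fst r) (snd r),
    Equiv.swap_comm (snd r) (snd t), Equiv.swap_mul_swap_mul_swap h3 h4, Equiv.swap_comm]

/-- Matsumoto's theorem for the symmetric group. -/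
theorem prod_map_eq_of_isReducedExpr {M : Type*} [Monoid M] (f : Fin (d - 1) → M)
    (hcomm : ∀ r t : Fin (d - 1), (r : ℕ) + 1 < t ∨ (t : ℕ) + 1 < r → f r * f t = f t * f r)
    (hbraid : ∀ r t : Fin (d - 1), (t : ℕ) = r + 1 → f t * f r * f t = f r * f t * f r)
    {w : Equiv.Perm (Fin d)} {L L' : List (Fin (d - 1))} (hL : IsReducedExpr L w)
    (hL' : IsReducedExpr L' w) : (L.map f).prod = (L'.map f).prod := by
  induction hm : L.length using Nat.strong_induction_on generalizing w L L' with
  | _ m ih =>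
    have hlen : L.length = L'.length := by
      rw [(isReducedExpr_iff.1 hL).2, (isReducedExpr_iff.1 hL').2]
    match L, L', hlen with
    | [], [], _ => rfl
    | r :: L, t :: L', hlen =>
      simp only [List.length_cons, Nat.add_right_cancel_iff] at hlen hm
      obtain ⟨hr, hL⟩ := hL.of_cons
      obtain ⟨ht, hL'⟩ := hL'.of_cons
      -- For distant `r` and `t`, `s_r` fixes both places of `s_t`, so a descent at `t` survives the
      -- removal of `s_r`.
      have far : ∀ r t : Fin (d - 1), (r : ℕ) + 1 < t ∨ (t : ℕ) + 1 < r →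
          w⁻¹ (snd t) < w⁻¹ (fst t) → (s r * w)⁻¹ (snd t) < (s r * w)⁻¹ (fst t) := by
        intro r t h ht
        simp only [mul_inv_rev, s_inv, Equiv.Perm.mul_apply]
        rwa [s_apply_of_ne (by simp [fst, snd, Fin.ext_iff]; omega)
          (by simp [snd, Fin.ext_iff]; omega), s_apply_of_ne (by simp [fst, Fin.ext_iff]; omega)
          (by simp [fst, snd, Fin.ext_iff]; omega)]
      -- With descents at two adjacent indices, the longest element of the copy of `𝔖_3` generated
      -- by `s_r`, `s_t` splits off on the left. The tails may then be replaced, by induction, with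
      -- `t r K` and `r t K` for a common `K`, and one braid move finishes.
      have near : ∀ (r t : Fin (d - 1)) (L L' : List (Fin (d - 1))), (t : ℕ) = r + 1 →
          L.length + 1 = m → L'.length + 1 = m →
          w⁻¹ (snd r) < w⁻¹ (fst r) → w⁻¹ (snd t) < w⁻¹ (fst t) →
          IsReducedExpr L (s r * w) → IsReducedExpr L' (s t * w) →
          f r * (L.map f).prod = f t * (L'.map f).prod := by
        intro r t L L' h hm hm' hr ht hL hL'
        have e1 : fst t = snd r := Fin.ext (by simp [fst, snd, h])
        have e2 : s t (fst r) = fst r := s_apply_of_ne (by simp [fst, Fin.ext_iff]; omega)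
          (by simp [fst, snd, Fin.ext_iff]; omega)
        have e3 : s r (snd t) = snd t := s_apply_of_ne (by simp [fst, snd, Fin.ext_iff]; omega)
          (by simp [snd, Fin.ext_iff]; omega)
        have e4 : s t (snd r) = snd t := by rw [← e1, s_fst]
        obtain ⟨K, hK⟩ := exists_isReducedExpr (s r * (s t * (s r * w)))
        have hb : s r * (s t * (s r * w)) = s t * (s r * (s t * w)) := by
          simpa [mul_assoc] using congrArg (· * w) (s_braid h).symm
        have k1 : IsReducedExpr (t :: r :: K) (s r * w) := by
          have a1 := hK.cons (r := r) (by
            simp only [mul_inv_rev, s_inv, Equiv.Perm.mul_apply, s_fst, s_snd, e2, e4, e3]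
            rwa [e1] at ht)
          rw [s_mul_s_mul] at a1
          have a2 := a1.cons (r := t) (by
            simp only [mul_inv_rev, s_inv, Equiv.Perm.mul_apply, s_snd, e1, e4, e3]
            rw [e1] at ht
            exact ht.trans hr)
          rwa [s_mul_s_mul] at a2
        have k2 : IsReducedExpr (r :: t :: K) (s t * w) := by
          rw [hb] at hK
          have a1 := hK.cons (r := t) (by
            simp only [mul_inv_rev, s_inv, Equiv.Perm.mul_apply, s_snd, e1, e3, e4, e2]
            exact hr)
          rw [s_mul_s_mul] at a1
          have a2 := a1.cons (r := r) (by
            simp only [mul_inv_rev, s_inv, Equiv.Perm.mul_apply, s_fst, s_snd, e2, e4]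
            rw [e1] at ht
            exact ht.trans hr)
          rwa [s_mul_s_mul] at a2
        rw [ih L.length (by omega) hL k1 rfl, ih L'.length (by omega) hL' k2 rfl]
        simp only [List.map_cons, List.prod_cons, ← mul_assoc]
        rw [hbraid r t h]
      simp only [List.map_cons, List.prod_cons]
      rcases lt_trichotomy (r : ℕ) t with h | h | h
      · rcases Nat.lt_or_ge ((r : ℕ) + 1) t with h' | h'
        -- The same scheme with commuting letters: the tails are replaced by `t K` and `r K`.
        · obtain ⟨K, hK⟩ := exists_isReducedExpr (s t * (s r * w))
          have k1 : IsReducedExpr (t :: K) (s r * w) := by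
            have := hK.cons (r := t) (by simpa using far r t (Or.inl h') ht)
            rwa [s_mul_s_mul] at this
          have k2 : IsReducedExpr (r :: K) (s t * w) := by
            rw [← mul_assoc, ← s_mul_comm (Or.inl h'), mul_assoc] at hK
            have := hK.cons (r := r) (by simpa using far t r (Or.inr h') hr)
            rwa [s_mul_s_mul] at this
          rw [ih L.length (by omega) hL k1 rfl, ih L'.length (by omega) hL' k2 rfl]
          simp only [List.map_cons, List.prod_cons, ← mul_assoc]
          rw [hcomm r t (Or.inl h')]
        · exact near r t L L' (by omega) hm (by omega) hr ht hL hL'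
      · obtain rfl := Fin.ext h
        rw [ih L.length (by omega) hL hL' rfl]
      · rcases Nat.lt_or_ge ((t : ℕ) + 1) r with h' | h'
        · obtain ⟨K, hK⟩ := exists_isReducedExpr (s t * (s r * w))
          have k1 : IsReducedExpr (t :: K) (s r * w) := by
            have := hK.cons (r := t) (by simpa using far r t (Or.inr h') ht)
            rwa [s_mul_s_mul] at this
          have k2 : IsReducedExpr (r :: K) (s t * w) := by
            rw [← mul_assoc, ← s_mul_comm (Or.inr h'), mul_assoc] at hK
            have := hK.cons (r := r) (by simpa using far t r (Or.inl h') hr)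
            rwa [s_mul_s_mul] at this
          rw [ih L.length (by omega) hL k1 rfl, ih L'.length (by omega) hL' k2 rfl]
          simp only [List.map_cons, List.prod_cons, ← mul_assoc]
          rw [hcomm r t (Or.inr h')]
        · exact (near t r L' L (by omega) (by omega) hm ht hr hL' hL).symm

end Perm

/-! ### Words of a positive root as permutations -/

section Words

variable {k : ℤ} {n : ℕ}

/-- Words of content `ρ(k, k + n)`. -/
abbrev RootWord (k : ℤ) (n : ℕ) : Type := Word (root k (k + n)) (n + 1)

theorem Word.letter_mem (i : RootWord k n) (p : Fin (n + 1)) :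
    k ≤ i.letter p ∧ i.letter p ≤ k + n := by
  have := i.mem_support p
  rw [Finsupp.mem_support_iff, root_apply] at this
  by_contra h
  exact this (if_neg fun hm => h (Finset.mem_Icc.1 hm))

/-- The permutation sending `r` to the position of the letter `k + r`. -/
noncomputable def Word.pos (i : RootWord k n) : Equiv.Perm (Fin (n + 1)) :=
  (Equiv.ofBijective (fun p => (⟨(i.letter p - k).toNat, by
    have := i.letter_mem p; omega⟩ : Fin (n + 1))) (by
    rw [← Finite.injective_iff_bijective]
    intro p q h
    have h1 := i.letter_mem p
    have h2 := i.letter_mem q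
    rw [Fin.mk.injEq] at h
    exact i.injective (by omega))).symm

theorem Word.letter_eq (i : RootWord k n) (p : Fin (n + 1)) :
    i.letter p = k + ((i.pos⁻¹ p : Fin (n + 1)) : ℕ) := by
  have := i.letter_mem p
  change _ = k + ((i.letter p - k).toNat : ℤ)
  omega

theorem Word.letter_pos (i : RootWord k n) (r : Fin (n + 1)) :
    i.letter (i.pos r) = k + (r : ℕ) := by
  simp [Word.letter_eq]

theorem Word.letter_act {α : ℤ →₀ ℕ} {d : ℕ} (i : Word α d) (w : Equiv.Perm (Fin d)) (p : Fin d) :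
    (i.act w).letter p = i.letter (w⁻¹ p) := rfl

theorem Word.pos_act (i : RootWord k n) (w : Equiv.Perm (Fin (n + 1))) :
    (i.act w).pos = w * i.pos := by
  ext1 r
  apply (i.act w).injective
  rw [Word.letter_pos, Word.letter_act, Equiv.Perm.mul_apply, Equiv.Perm.inv_def,
    Equiv.symm_apply_apply, Word.letter_pos]

theorem Word.act_mul {α : ℤ →₀ ℕ} {d : ℕ} (i : Word α d) (v w : Equiv.Perm (Fin d)) :
    i.act (v * w) = (i.act w).act v :=
  Word.ext' fun r => by simp [Word.letter_act]

@[simp] theorem Word.act_one {α : ℤ →₀ ℕ} {d : ℕ} (i : Word α d) : i.act 1 = i :=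
  Word.ext' fun r => by simp [Word.letter_act]

@[simp] theorem Word.act_s_s {α : ℤ →₀ ℕ} {d : ℕ} (i : Word α d) (r : Fin (d - 1)) :
    (i.act (s r)).act (s r) = i := by
  rw [← Word.act_mul, s_mul_s, Word.act_one]

/-- Multiplicity-freeness of the root in the form in which it removes the correction term of the
dot-slide relation and the case `Q_{ii} = 0`. -/
theorem Word.letter_fst_ne {k l : ℤ} {d : ℕ} (i : Word (root k l) d) (r : Fin (d - 1)) :
    i.letter (fst r) ≠ i.letter (snd r) :=
  fun h => (fst_lt_snd r).ne (i.injective h)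

end Words

theorem cartan_eq_zero_iff {i j : ℤ} (h : i ≠ j) : cartan i j = 0 ↔ |i - j| ≠ 1 := by
  unfold cartan
  rw [if_neg h]
  split_ifs with h' <;> simp [h']

/-! ### Relations in the KLR algebra of a positive root -/

namespace KLR

section Relations

variable (O : Type*) [CommRing O] (ε : ℤ → ℤ → ℤˣ) {α : ℤ →₀ ℕ} {d : ℕ}

theorem mk_eq {x y : FreeAlgebra O (Gen α d)} (h : KLRRel O ε α d x y) :
    mk O ε α d x = mk O ε α d y :=
  RingQuot.mkAlgHom_rel O h

theorem mk_surjective : Function.Surjective (mk O ε α d) :=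
  RingQuot.mkAlgHom_surjective O _

theorem sum_idem : ∑ i : Word α d, idem O ε i = 1 := by
  have := mk_eq O ε (KLRRel.idem_sum (O := O) (ε := ε) (α := α) (d := d))
  rwa [map_sum, map_one] at this

theorem idem_mul_self (i : Word α d) : idem O ε i * idem O ε i = idem O ε i := by
  rw [idem_mul_idem, if_pos rfl]

variable {O ε}

theorem ext_idem {a b : KLR O ε α d} (h : ∀ i, a * idem O ε i = b * idem O ε i) : a = b := by
  rw [← mul_one a, ← mul_one b, ← sum_idem, Finset.mul_sum, Finset.mul_sum]
  exact Finset.sum_congr rfl fun i _ => h i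

variable (O ε)

theorem y_mul_idem (r : Fin d) (i : Word α d) :
    y O ε r * idem O ε i = idem O ε i * y O ε r := by
  simpa [idem, y] using mk_eq O ε (KLRRel.y_idem (O := O) (ε := ε) r i)

theorem y_mul_y (r t : Fin d) :
    (y O ε r * y O ε t : KLR O ε α d) = y O ε t * y O ε r := by
  simpa [y] using mk_eq O ε (KLRRel.y_comm (O := O) (ε := ε) (α := α) r t)

theorem psi_mul_idem (r : Fin (d - 1)) (i : Word α d) :
    psi O ε r * idem O ε i = idem O ε (i.act (s r)) * psi O ε r := by
  simpa [idem, psi] using mk_eq O ε (KLRRel.psi_idem (O := O) (ε := ε) r i)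

theorem psi_mul_psi (r t : Fin (d - 1)) (h : (r : ℕ) + 1 < t ∨ (t : ℕ) + 1 < r) :
    (psi O ε r * psi O ε t : KLR O ε α d) = psi O ε t * psi O ε r := by
  simpa [psi] using mk_eq O ε (KLRRel.psi_comm (O := O) (ε := ε) (α := α) r t h)

theorem psiList_mul_idem (L : List (Fin (d - 1))) (i : Word α d) :
    psiList O ε α L * idem O ε i = idem O ε (i.act (L.map s).prod) * psiList O ε α L := by
  induction L with
  | nil => simp [psiList]
  | cons r L ih =>
    simp only [psiList, List.map_cons, List.prod_cons] at ih ⊢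
    rw [mul_assoc, ih, ← mul_assoc, psi_mul_idem, mul_assoc, Word.act_mul]

theorem psiPerm_mul_idem (w : Equiv.Perm (Fin d)) (i : Word α d) :
    psiPerm O ε α w * idem O ε i = idem O ε (i.act w) * psiPerm O ε α w := by
  have := psiList_mul_idem O ε (exists_isReducedExpr w).choose i
  rwa [(exists_isReducedExpr w).choose_spec.1] at this

variable {k l : ℤ}

/-- The correction term only occurs for equal adjacent letters, which a root word does not have. -/
theorem y_mul_psi (t : Fin d) (r : Fin (d - 1)) :
    (y O ε t * psi O ε r : KLR O ε (root k l) d) = psi O ε r * y O ε (s r t) := by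
  apply ext_idem
  intro i
  have := mk_eq O ε (KLRRel.y_psi (O := O) (ε := ε) t r i)
  rw [if_neg (i.letter_fst_ne r), zero_mul, map_zero, map_mul, map_sub, map_mul, map_mul,
    sub_mul, sub_eq_zero] at this
  exact this

/-- The right side of the relation needs equal outer letters, so it vanishes; this is the braid
hypothesis of Matsumoto's theorem. -/
theorem psi_braid (r t : Fin (d - 1)) (h : (t : ℕ) = r + 1) :
    (psi O ε t * psi O ε r * psi O ε t : KLR O ε (root k l) d) =
      psi O ε r * psi O ε t * psi O ε r := by
  apply ext_idem
  intro i
  have := mk_eq O ε (KLRRel.braid (O := O) (ε := ε) r t h i)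
  rw [if_neg (fun h' => by
    have := i.injective h'
    simp [fst, snd, Fin.ext_iff] at this
    omega), zero_mul, map_zero, map_mul, map_sub, sub_mul, sub_eq_zero] at this
  simpa [psi, idem, map_mul] using this

theorem psi_sq (r : Fin (d - 1)) (i : Word α d) :
    psi O ε r * psi O ε r * idem O ε i =
      Q ε (i.letter (fst r)) (i.letter (snd r)) (y O ε (fst r)) (y O ε (snd r)) * idem O ε i := by
  have := mk_eq O ε (KLRRel.psi_sq (O := O) (ε := ε) r i)
  rw [map_mul, map_mul, map_mul] at this
  refine this.trans ?_
  congr 1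
  unfold Q
  split_ifs <;> simp [y]

theorem psiList_eq_psiPerm {w : Equiv.Perm (Fin d)} {L : List (Fin (d - 1))}
    (h : IsReducedExpr L w) : psiList O ε (root k l) L = psiPerm O ε (root k l) w :=
  prod_map_eq_of_isReducedExpr (psi O ε) (psi_mul_psi O ε) (psi_braid O ε) h
    (exists_isReducedExpr w).choose_spec

theorem psiPerm_one : psiPerm O ε (root k l) (1 : Equiv.Perm (Fin d)) = 1 :=
  (psiList_eq_psiPerm O ε (L := []) ⟨rfl, fun _ _ => Nat.zero_le _⟩).symm

theorem psi_mul_psiPerm {w : Equiv.Perm (Fin d)} {r : Fin (d - 1)}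
    (h : w⁻¹ (fst r) < w⁻¹ (snd r)) :
    psi O ε r * psiPerm O ε (root k l) w = psiPerm O ε (root k l) (s r * w) := by
  obtain ⟨L, hL⟩ := exists_isReducedExpr w
  rw [← psiList_eq_psiPerm O ε hL, ← psiList_eq_psiPerm O ε (hL.cons h)]
  simp [psiList]

end Relations

/-! ### Central elements -/

section Center

variable (O : Type*) [CommRing O] (ε : ℤ → ℤ → ℤˣ) (k : ℤ) {n : ℕ}

/-- The central element which acts on `1_i` as the dot on the strand coloured by `k + r`. -/
noncomputable def dot (r : Fin (n + 1)) : KLR O ε (root k (k + n)) (n + 1) :=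
  ∑ i : RootWord k n, y O ε (i.pos r) * idem O ε i

theorem dot_mul_idem (r : Fin (n + 1)) (i : RootWord k n) :
    dot O ε k r * idem O ε i = y O ε (i.pos r) * idem O ε i := by
  classical
  rw [dot, Finset.sum_mul, Finset.sum_eq_single i]
  · rw [mul_assoc, idem_mul_self]
  · intro j _ hj
    rw [mul_assoc, idem_mul_idem, if_neg hj, mul_zero]
  · simp

theorem y_mul_idem_eq_dot (p : Fin (n + 1)) (i : RootWord k n) :
    y O ε p * idem O ε i = dot O ε k (i.pos⁻¹ p) * idem O ε i := by
  rw [dot_mul_idem, Equiv.Perm.inv_def, Equiv.apply_symm_apply]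

variable {O ε} in
theorem mem_center {α : ℤ →₀ ℕ} {d : ℕ} {x : KLR O ε α d}
    (h1 : ∀ i, x * idem O ε i = idem O ε i * x) (h2 : ∀ r, x * y O ε r = y O ε r * x)
    (h3 : ∀ r, x * psi O ε r = psi O ε r * x) : x ∈ Subalgebra.center O (KLR O ε α d) := by
  rw [Subalgebra.mem_center_iff]
  intro b
  obtain ⟨b, rfl⟩ := mk_surjective O ε b
  induction b using FreeAlgebra.induction with
  | grade0 c => rw [AlgHom.commutes]; exact Algebra.commutes c x
  | grade1 g =>
    cases g with
    | idem i => exact (h1 i).symm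
    | y r => exact (h2 r).symm
    | psi r => exact (h3 r).symm
  | mul a b ha hb => rw [map_mul, mul_assoc, hb, ← mul_assoc, ha, mul_assoc]
  | add a b ha hb => rw [map_add, add_mul, mul_add, ha, hb]

/-- A crossing moves the strand of a given colour to its new place and, without correction terms,
takes the dot along. -/
theorem dot_mem_center (r : Fin (n + 1)) :
    dot O ε k r ∈ Subalgebra.center O (KLR O ε (root k (k + n)) (n + 1)) := by
  have hi : ∀ i, dot O ε k r * idem O ε i = idem O ε i * dot O ε k r := by
    intro i
    classical
    rw [dot_mul_idem, dot, Finset.mul_sum, Finset.sum_eq_single i]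
    · rw [← mul_assoc, ← y_mul_idem, mul_assoc, idem_mul_self]
    · intro j _ hj
      rw [← mul_assoc, ← y_mul_idem, mul_assoc, idem_mul_idem, if_neg hj.symm, mul_zero]
    · simp
  refine mem_center hi (fun t => ext_idem fun i => ?_) (fun t => ext_idem fun i => ?_)
  · rw [mul_assoc, y_mul_idem, ← mul_assoc, dot_mul_idem, mul_assoc, mul_assoc, dot_mul_idem,
      ← y_mul_idem, ← mul_assoc, ← mul_assoc, y_mul_y]
  · rw [mul_assoc, psi_mul_idem, ← mul_assoc, dot_mul_idem, Word.pos_act, mul_assoc,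
      ← psi_mul_idem, ← mul_assoc, y_mul_psi, Equiv.Perm.mul_apply, s_s, mul_assoc, mul_assoc,
      dot_mul_idem]

/-- The central element `ε(x_r - x_{r+1})`, where `x_r` is the `r`-th `dot`. -/
noncomputable def z (r : Fin n) : Subalgebra.center O (KLR O ε (root k (k + n)) (n + 1)) :=
  ((ε (k + (r : ℕ)) (k + (r : ℕ) + 1) : ℤ) : Subalgebra.center O _) *
    (⟨dot O ε k r.castSucc, dot_mem_center O ε k _⟩ - ⟨dot O ε k r.succ, dot_mem_center O ε k _⟩)

theorem coe_z (r : Fin n) : (z O ε k r : KLR O ε (root k (k + n)) (n + 1)) =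
    ((ε (k + (r : ℕ)) (k + (r : ℕ) + 1) : ℤ) : KLR O ε (root k (k + n)) (n + 1)) *
      (dot O ε k r.castSucc - dot O ε k r.succ) := by
  simp [z]

theorem coe_z' (r : Fin n) : (z O ε k r : KLR O ε (root k (k + n)) (n + 1)) =
    (ε (k + (r : ℕ)) (k + (r : ℕ) + 1) : ℤ) •
      (dot O ε k r.castSucc - dot O ε k r.succ) := by
  rw [coe_z, zsmul_eq_mul]

theorem mul_coe_center {A : Type*} [Ring A] [Algebra O A] (c : Subalgebra.center O A) (x : A) :
    x * c = c * x :=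
  Subalgebra.mem_center_iff.1 c.2 x

/-- Differences of dots telescope, and the sign in `z_r` is invertible. This is why the generators
`y_r - y_{r+1}` of `R'_ρ` bring in nothing beyond the `z_r`. -/
theorem dot_sub_mem_span (a b : Fin (n + 1)) :
    (dot O ε k a - dot O ε k b : KLR O ε (root k (k + n)) (n + 1)) ∈
      Submodule.span O (Set.range fun r : Fin n => (z O ε k r).1) := by
  have main : ∀ a : Fin (n + 1), (dot O ε k a - dot O ε k 0 : KLR O ε (root k (k + n)) (n + 1)) ∈
      Submodule.span O (Set.range fun r : Fin n => (z O ε k r).1) := by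
    intro a
    induction a using Fin.induction with
    | zero => simp
    | succ r ih =>
      have h : (dot O ε k r.succ - dot O ε k 0 : KLR O ε (root k (k + n)) (n + 1)) =
          (dot O ε k r.castSucc - dot O ε k 0) -
            (ε (k + (r : ℕ)) (k + (r : ℕ) + 1) : ℤ) • (z O ε k r).1 := by
        rw [coe_z', smul_smul, Int.units_coe_mul_self, one_smul]
        abel
      rw [h]
      exact sub_mem ih (zsmul_mem (Submodule.subset_span (Set.mem_range_self r)) _)
  have := sub_mem (main a) (main b)
  rwa [sub_sub_sub_cancel_right] at this

/-- Exchanging two neighbouring letters flips the sign of both `ε_{ij}` and the difference of dots,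
so either order gives the same central element. The index `r` is that of the smaller letter. -/
theorem psi_sq_cases {ε : ℤ → ℤ → ℤˣ} (hε : ∀ i j : ℤ, |i - j| = 1 → ε i j * ε j i = -1)
    (q : Fin (n + 1 - 1)) (i : RootWord k n) :
    (∃ r : Fin n, psi O ε q * psi O ε q * idem O ε i = (z O ε k r).1 * idem O ε i) ∨
      psi O ε q * psi O ε q * idem O ε i = idem O ε i := by
  rw [psi_sq, Q, if_neg (i.letter_fst_ne q)]
  split_ifs with h
  · right; rw [one_mul]
  · left
    rw [cartan_eq_zero_iff (i.letter_fst_ne q), not_not] at h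
    rw [mul_assoc, sub_mul, y_mul_idem_eq_dot, y_mul_idem_eq_dot, ← sub_mul, ← mul_assoc]
    rw [i.letter_eq, i.letter_eq] at h ⊢
    generalize i.pos⁻¹ (fst q) = a at *
    generalize i.pos⁻¹ (snd q) = b at *
    have ha := a.is_lt
    have hb := b.is_lt
    rcases (abs_eq zero_le_one).1 h with h' | h'
    · refine ⟨⟨b, by omega⟩, ?_⟩
      rw [coe_z]
      have e1 : (⟨b, by omega⟩ : Fin n).castSucc = b := rfl
      have e2 : (⟨b, by omega⟩ : Fin n).succ = a := Fin.ext (by simp; omega)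
      have e3 : k + ((b : ℕ) : ℤ) + 1 = k + (a : ℕ) := by omega
      rw [e1, e2, e3]
      have e4 := hε _ _ h
      have e5 : ((ε (k + (b : ℕ)) (k + (a : ℕ)) : ℤˣ) : ℤ) =
          -(ε (k + (a : ℕ)) (k + (b : ℕ)) : ℤˣ) := by
        rw [← Units.val_neg, Units.val_inj]
        rw [← mul_left_cancel_iff (a := ε (k + (a : ℕ)) (k + (b : ℕ))), e4, mul_neg,
          Int.units_mul_self]
      rw [e5, Int.cast_neg, neg_mul, ← mul_neg, neg_sub]
    · refine ⟨⟨a, by omega⟩, ?_⟩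
      rw [coe_z]
      have e1 : (⟨a, by omega⟩ : Fin n).castSucc = a := rfl
      have e2 : (⟨a, by omega⟩ : Fin n).succ = b := Fin.ext (by simp; omega)
      have e3 : k + ((a : ℕ) : ℤ) + 1 = k + (b : ℕ) := by omega
      rw [e1, e2, e3]

/-! ### A spanning set of `R'_ρ` -/

/-- The monomials in the central elements `z`. -/
noncomputable def zmon (a : Fin n → ℕ) :
    Subalgebra.center O (KLR O ε (root k (k + n)) (n + 1)) :=
  ∏ r, z O ε k r ^ a r

theorem z_mul_zmon (r : Fin n) (a : Fin n → ℕ) :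
    (z O ε k r * zmon O ε k a : Subalgebra.center O (KLR O ε (root k (k + n)) (n + 1))) =
      zmon O ε k (a + Pi.single r 1) := by
  classical
  simp only [zmon, Pi.add_apply, pow_add, Finset.prod_mul_distrib]
  rw [mul_comm]
  congr 1
  rw [Finset.prod_eq_single r]
  · simp
  · intro t _ ht
    simp [Pi.single_eq_of_ne ht]
  · simp

/-- The element `z^a ψ_w 1_i`. -/
noncomputable def stdElem (a : Fin n → ℕ) (w : Equiv.Perm (Fin (n + 1))) (i : RootWord k n) :
    KLR O ε (root k (k + n)) (n + 1) :=
  (zmon O ε k a).1 * (psiPerm O ε _ w * idem O ε i)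

theorem mul_stdElem (x : KLR O ε (root k (k + n)) (n + 1)) (a : Fin n → ℕ)
    (w : Equiv.Perm (Fin (n + 1))) (i : RootWord k n) :
    x * stdElem O ε k a w i = (zmon O ε k a).1 * (x * (psiPerm O ε _ w * idem O ε i)) := by
  rw [stdElem, ← mul_assoc, mul_coe_center, mul_assoc]

theorem idem_mul_stdElem (a : Fin n → ℕ) (w : Equiv.Perm (Fin (n + 1))) (i : RootWord k n) :
    idem O ε (i.act w) * stdElem O ε k a w i = stdElem O ε k a w i := by
  rw [mul_stdElem, psiPerm_mul_idem, ← mul_assoc (idem O ε _), idem_mul_self, stdElem,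
    psiPerm_mul_idem]

variable (n) in
/-- The span of all elements `z^a ψ_w 1_i`. -/
noncomputable def stdSpan : Submodule O (KLR O ε (root k (k + n)) (n + 1)) :=
  Submodule.span O (Set.range fun p : (Fin n → ℕ) × Equiv.Perm (Fin (n + 1)) × RootWord k n =>
    stdElem O ε k p.1 p.2.1 p.2.2)

theorem stdElem_mem (a : Fin n → ℕ) (w : Equiv.Perm (Fin (n + 1))) (i : RootWord k n) :
    stdElem O ε k a w i ∈ stdSpan O ε k n :=
  Submodule.subset_span ⟨(a, w, i), rfl⟩

theorem z_mul_stdElem_mem (r : Fin n) (a : Fin n → ℕ) (w : Equiv.Perm (Fin (n + 1)))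
    (i : RootWord k n) : (z O ε k r : KLR O ε (root k (k + n)) (n + 1)) * stdElem O ε k a w i ∈
      stdSpan O ε k n := by
  rw [stdElem, ← mul_assoc, ← MulMemClass.coe_mul, z_mul_zmon]
  exact stdElem_mem O ε k _ w i

theorem one_mem_stdSpan : 1 ∈ stdSpan O ε k n := by
  rw [← sum_idem]
  refine sum_mem fun i _ => ?_
  have := stdElem_mem O ε k (0 : Fin n → ℕ) 1 i
  rwa [stdElem, psiPerm_one, zmon, one_mul, Finset.prod_congr rfl (fun r _ => by
    rw [Pi.zero_apply, pow_zero]), Finset.prod_const_one, OneMemClass.coe_one, one_mul] at this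

/-- The span contains 1 and is stable under left multiplication by the generators of `R'_ρ`, so it
contains the whole algebra. -/
theorem R'_le_stdSpan {ε : ℤ → ℤ → ℤˣ} (hε : ∀ i j : ℤ, |i - j| = 1 → ε i j * ε j i = -1)
    {x : KLR O ε (root k (k + n)) (n + 1)} (hx : x ∈ R' O ε (root k (k + n)) (n + 1)) :
    x ∈ stdSpan O ε k n := by
  suffices h : ∀ v ∈ stdSpan O ε k n, x * v ∈ stdSpan O ε k n by
    simpa using h 1 (one_mem_stdSpan O ε k)
  have red : ∀ x : KLR O ε (root k (k + n)) (n + 1),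
      (∀ a w i, x * stdElem O ε k a w i ∈ stdSpan O ε k n) →
        ∀ v ∈ stdSpan O ε k n, x * v ∈ stdSpan O ε k n := by
    intro x h v hv
    induction hv using Submodule.span_induction with
    | mem v hv => obtain ⟨p, rfl⟩ := hv; exact h _ _ _
    | zero => simp
    | add v v' _ _ hv hv' => rw [mul_add]; exact add_mem hv hv'
    | smul c v _ hv => rw [mul_smul_comm]; exact Submodule.smul_mem _ _ hv
  rw [R'] at hx
  induction hx using Algebra.adjoin_induction with
  | mem x hx =>
    refine red x fun a w i => ?_
    rcases hx with (⟨j, rfl⟩ | ⟨q, rfl⟩) | ⟨q, rfl⟩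
    · classical
      rw [mul_stdElem, psiPerm_mul_idem, ← mul_assoc (idem O ε j), idem_mul_idem]
      split_ifs with h
      · subst h
        rw [← psiPerm_mul_idem]
        exact stdElem_mem O ε k a w i
      · simp
    -- The element is fixed by left multiplication with `1_{w·i}`, so dots at places become central
    -- dots of the colours standing there.
    · have h : (y O ε (fst q) - y O ε (snd q)) * stdElem O ε k a w i =
          (dot O ε k ((i.act w).pos⁻¹ (fst q)) - dot O ε k ((i.act w).pos⁻¹ (snd q))) *
            stdElem O ε k a w i := by
        rw [← idem_mul_stdElem, ← mul_assoc, ← mul_assoc, sub_mul, sub_mul (dot O ε k _),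
          y_mul_idem_eq_dot, y_mul_idem_eq_dot]
      change (y O ε (fst q) - y O ε (snd q)) * stdElem O ε k a w i ∈ _
      rw [h]
      have := dot_sub_mem_span O ε k ((i.act w).pos⁻¹ (fst q)) ((i.act w).pos⁻¹ (snd q))
      generalize (dot O ε k ((i.act w).pos⁻¹ (fst q)) - dot O ε k ((i.act w).pos⁻¹ (snd q)) :
        KLR O ε (root k (k + n)) (n + 1)) = u at this
      induction this using Submodule.span_induction with
      | mem v hv => obtain ⟨r, rfl⟩ := hv; exact z_mul_stdElem_mem O ε k r a w i
      | zero => simp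
      | add v v' _ _ hv hv' => rw [add_mul]; exact add_mem hv hv'
      | smul c v _ hv => rw [smul_mul_assoc]; exact Submodule.smul_mem _ _ hv
    · rcases lt_or_gt_of_perm w q with h | h
      · rw [mul_stdElem, ← mul_assoc (psi O ε q), psi_mul_psiPerm O ε h]
        exact stdElem_mem O ε k a _ i
      -- At a descent `ψ_w = ψ_q ψ_{s_q w}`, and the square `ψ_q²` that appears is central or
      -- trivial on the idempotent.
      · have h' := psi_mul_psiPerm O ε (k := k) (l := k + n) (w := s q * w) (r := q)
          (by simpa using h)
        rw [s_mul_s_mul] at h'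
        rw [mul_stdElem, ← h', ← mul_assoc (psi O ε q) (_ * _), ← mul_assoc (psi O ε q) (psi O ε q),
          mul_assoc (psi O ε q * psi O ε q), ← mul_stdElem, ← idem_mul_stdElem, ← mul_assoc]
        rcases psi_sq_cases O k hε q (i.act (s q * w)) with ⟨r, hr⟩ | hr
        · rw [hr, mul_assoc, idem_mul_stdElem]
          exact z_mul_stdElem_mem O ε k r a _ i
        · rw [hr, idem_mul_stdElem]
          exact stdElem_mem O ε k a _ i
  | algebraMap c =>
    intro v hv
    rw [← Algebra.smul_def]
    exact Submodule.smul_mem _ _ hv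
  | add x x' _ _ hx hx' => intro v hv; rw [add_mul]; exact add_mem (hx v hv) (hx' v hv)
  | mul x x' _ _ hx hx' => intro v hv; rw [mul_assoc]; exact hx _ (hx' v hv)

end Center

end KLR

/-! ### The polynomial representation -/

section Weights

variable (O : Type*) [CommRing O] (ε : ℤ → ℤ → ℤˣ) (k : ℤ)

/-- The weight of a crossing of strands coloured by `a` and `b`. -/
noncomputable def crossWeight (a b : ℤ) : MvPolynomial ℤ O :=
  if |a - b| = 1 then MvPolynomial.X (min a b) else 1

theorem crossWeight_comm (a b : ℤ) : crossWeight O a b = crossWeight O b a := by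
  rw [crossWeight, crossWeight, abs_sub_comm, min_comm]

/-- The weight of a dot on a strand coloured by `c`. -/
noncomputable def dotWeight (c : ℤ) : MvPolynomial ℤ O :=
  -∑ t ∈ Finset.range (c - k).toNat, (ε (k + t) (k + t + 1) : ℤ) • MvPolynomial.X (k + t) ^ 2

/-- The dot weights are partial sums starting at `k`, chosen so that consecutive differences are
squares up to sign; this leaves room for the square root `X_c` as a crossing weight. For `c` at
least `k` the truncation `toNat` loses nothing. -/
theorem dotWeight_sub {c : ℤ} (hc : k ≤ c) :
    (ε c (c + 1) : ℤ) • (dotWeight O ε k c - dotWeight O ε k (c + 1)) =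
      (MvPolynomial.X c ^ 2 : MvPolynomial ℤ O) := by
  have h : (c + 1 - k).toNat = (c - k).toNat + 1 := by omega
  have h' : k + ((c - k).toNat : ℤ) = c := by omega
  rw [dotWeight, dotWeight, h, Finset.sum_range_succ, h', neg_sub_neg, add_sub_cancel_left,
    smul_smul, Int.units_coe_mul_self, one_smul]

/-- The quadratic relation at the level of weights. The crossing weight is symmetric in the colours,
and the sign condition on `ε` makes the right side symmetric as well. -/
theorem crossWeight_sq {ε : ℤ → ℤ → ℤˣ} (hε : ∀ i j : ℤ, |i - j| = 1 → ε i j * ε j i = -1)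
    {a b : ℤ} (ha : k ≤ a) (hb : k ≤ b) :
    crossWeight O a b * crossWeight O a b =
      if |a - b| = 1 then (ε a b : ℤ) • (dotWeight O ε k a - dotWeight O ε k b) else 1 := by
  rw [crossWeight]
  split_ifs with h
  · rcases (abs_eq zero_le_one).1 h with h' | h'
    · obtain rfl : a = b + 1 := by omega
      have e5 : ((ε (b + 1) b : ℤˣ) : ℤ) = -(ε b (b + 1) : ℤˣ) := by
        rw [← Units.val_neg, Units.val_inj, ← mul_left_cancel_iff (a := ε b (b + 1)),
          hε b (b + 1) (by simp), mul_neg, Int.units_mul_self]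
      rw [e5, neg_smul, ← smul_neg, neg_sub, dotWeight_sub O ε k hb, min_eq_right (by omega), sq]
    · obtain rfl : b = a + 1 := by omega
      rw [dotWeight_sub O ε k ha, min_eq_left (by omega), sq]
  · rw [one_mul]

end Weights

theorem map_Q {A C : Type*} [Ring A] [Ring C] (f : A →+* C) (ε : ℤ → ℤ → ℤˣ) (i j : ℤ) (u v : A) :
    f (Q ε i j u v) = Q ε i j (f u) (f v) := by
  unfold Q
  split_ifs <;> simp

/-! ### Operators on polynomial-valued functions of words, and the KLR relations between them -/

section Representation

variable (O : Type*) [CommRing O] (ε : ℤ → ℤ → ℤˣ) (k : ℤ) (n : ℕ)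

/-- The space of the polynomial representation. -/
abbrev PolySpace : Type _ := RootWord k n → MvPolynomial ℤ O

variable {k n}

open Classical in
/-- The action of `1_i`. -/
noncomputable def opIdem (j : RootWord k n) : Module.End (MvPolynomial ℤ O) (PolySpace O k n) where
  toFun f i := if i = j then f i else 0
  map_add' f g := by ext1 i; simp only [Pi.add_apply]; split_ifs <;> simp
  map_smul' c f := by ext1 i; simp

/-- The action of `y_r`. -/
noncomputable def opY (r : Fin (n + 1)) : Module.End (MvPolynomial ℤ O) (PolySpace O k n) where
  toFun f i := dotWeight O ε k (i.letter r) * f i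
  map_add' f g := by ext1 i; simp [mul_add]
  map_smul' c f := by ext1 i; simp [mul_left_comm]

/-- The action of `ψ_r`. -/
noncomputable def opPsi (r : Fin (n + 1 - 1)) :
    Module.End (MvPolynomial ℤ O) (PolySpace O k n) where
  toFun f i := crossWeight O (i.letter (fst r)) (i.letter (snd r)) * f (i.act (s r))
  map_add' f g := by ext1 i; simp [mul_add]
  map_smul' c f := by ext1 i; simp [mul_left_comm]

open Classical in
@[simp] theorem opIdem_apply (j : RootWord k n) (f : PolySpace O k n) (i : RootWord k n) :
    opIdem O j f i = if i = j then f i else 0 := rfl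

@[simp] theorem opY_apply (r : Fin (n + 1)) (f : PolySpace O k n) (i : RootWord k n) :
    opY O ε r f i = dotWeight O ε k (i.letter r) * f i := rfl

@[simp] theorem opPsi_apply (r : Fin (n + 1 - 1)) (f : PolySpace O k n) (i : RootWord k n) :
    opPsi O r f i =
      crossWeight O (i.letter (fst r)) (i.letter (snd r)) * f (i.act (s r)) := rfl

/-- The action of the generators. -/
noncomputable def opGen :
    Gen (root k (k + n)) (n + 1) → Module.End (MvPolynomial ℤ O) (PolySpace O k n)
  | .idem i => opIdem O i
  | .y r => opY O ε r
  | .psi r => opPsi O r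

/-- The action of the free algebra. -/
noncomputable def freeRep : FreeAlgebra O (Gen (root k (k + n)) (n + 1)) →ₐ[O]
    Module.End (MvPolynomial ℤ O) (PolySpace O k n) :=
  FreeAlgebra.lift O (opGen O ε)

@[simp] theorem freeRep_fe (i : RootWord k n) : freeRep O ε (fe O i) = opIdem O i :=
  FreeAlgebra.lift_ι_apply _ _

@[simp] theorem freeRep_fy (r : Fin (n + 1)) :
    freeRep O ε (fy O r : FreeAlgebra O (Gen (root k (k + n)) (n + 1))) = opY O ε r :=
  FreeAlgebra.lift_ι_apply _ _

@[simp] theorem freeRep_fpsi (r : Fin (n + 1 - 1)) :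
    freeRep O ε (fpsi O r : FreeAlgebra O (Gen (root k (k + n)) (n + 1))) = opPsi O r :=
  FreeAlgebra.lift_ι_apply _ _

theorem Word.act_s_eq_iff {α : ℤ →₀ ℕ} {d : ℕ} {i j : Word α d} {r : Fin (d - 1)} :
    i.act (s r) = j ↔ i = j.act (s r) := by
  constructor
  · rintro rfl; simp
  · rintro rfl; simp

/-- Both sides permute words in the same way and multiply by the weights of the same three pairs of
strands, in a different order. -/
theorem opPsi_braid (r t : Fin (n + 1 - 1)) (h : (t : ℕ) = r + 1) :
    (opPsi O t * opPsi O r * opPsi O t : Module.End _ (PolySpace O k n)) =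
      opPsi O r * opPsi O t * opPsi O r := by
  have e1 : fst t = snd r := Fin.ext (by simp [fst, snd, h])
  have e2 : s t (fst r) = fst r := s_apply_of_ne (by simp [fst, Fin.ext_iff]; omega)
    (by simp [fst, snd, Fin.ext_iff]; omega)
  have e3 : s r (snd t) = snd t := s_apply_of_ne (by simp [fst, snd, Fin.ext_iff]; omega)
    (by simp [snd, Fin.ext_iff]; omega)
  have e4 : s t (snd r) = snd t := by rw [← e1, s_fst]
  refine LinearMap.ext fun f => ?_
  ext1 i
  simp only [Module.End.mul_apply, opPsi_apply, ← Word.act_mul, Word.letter_act, mul_inv_rev,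
    s_inv, Equiv.Perm.mul_apply, e1, e2, e3, e4, s_fst, s_snd, ← mul_assoc, s_braid h]
  ring

theorem opPsi_comm (r t : Fin (n + 1 - 1)) (h : (r : ℕ) + 1 < t ∨ (t : ℕ) + 1 < r) :
    (opPsi O r * opPsi O t : Module.End _ (PolySpace O k n)) = opPsi O t * opPsi O r := by
  have e1 : s t (fst r) = fst r := s_apply_of_ne (by simp [fst, Fin.ext_iff]; omega)
    (by simp [fst, snd, Fin.ext_iff]; omega)
  have e2 : s t (snd r) = snd r := s_apply_of_ne (by simp [fst, snd, Fin.ext_iff]; omega)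
    (by simp [snd, Fin.ext_iff]; omega)
  have e3 : s r (fst t) = fst t := s_apply_of_ne (by simp [fst, Fin.ext_iff]; omega)
    (by simp [fst, snd, Fin.ext_iff]; omega)
  have e4 : s r (snd t) = snd t := s_apply_of_ne (by simp [fst, snd, Fin.ext_iff]; omega)
    (by simp [snd, Fin.ext_iff]; omega)
  refine LinearMap.ext fun f => ?_
  ext1 i
  simp only [Module.End.mul_apply, opPsi_apply, ← Word.act_mul, Word.letter_act,
    s_inv, e1, e2, e3, e4, s_mul_comm h]
  ring

/-- All correction terms vanish on root words, so the operators only have to be commuting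
multiplications combined with permutations. The one relation tying dot weights to crossing weights
is the quadratic one. -/
theorem freeRep_eq {ε : ℤ → ℤ → ℤˣ} (hε : ∀ i j : ℤ, |i - j| = 1 → ε i j * ε j i = -1)
    {x y : FreeAlgebra O (Gen (root k (k + n)) (n + 1))} (h : KLRRel O ε _ _ x y) :
    freeRep O ε x = freeRep O ε y := by
  classical
  cases h with
  | idem_mul i j =>
    refine LinearMap.ext fun f => ?_
    ext1 p
    rw [map_mul, freeRep_fe, freeRep_fe, Module.End.mul_apply, opIdem_apply, opIdem_apply]
    by_cases hij : i = j
    · subst hij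
      simp only [if_true, freeRep_fe, opIdem_apply]
      split_ifs <;> rfl
    · rw [if_neg hij, map_zero]
      by_cases hp : p = i
      · subst hp; simp [hij]
      · simp [hp]
  | idem_sum =>
    refine LinearMap.ext fun f => ?_
    ext1 p
    rw [map_sum, map_one, LinearMap.sum_apply, Finset.sum_apply]
    simp
  | y_idem r i =>
    refine LinearMap.ext fun f => ?_
    ext1 p
    rw [map_mul, map_mul, freeRep_fe, freeRep_fy]
    simp
  | y_comm r t =>
    refine LinearMap.ext fun f => ?_
    ext1 p
    rw [map_mul, map_mul, freeRep_fy, freeRep_fy]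
    simp [mul_left_comm]
  | psi_idem r i =>
    refine LinearMap.ext fun f => ?_
    ext1 p
    rw [map_mul, map_mul, freeRep_fe, freeRep_fe, freeRep_fpsi]
    simp [Word.act_s_eq_iff]
  | y_psi t r i =>
    rw [if_neg (i.letter_fst_ne r), zero_mul, map_zero, map_mul, map_sub, map_mul, map_mul,
      freeRep_fy, freeRep_fy, freeRep_fpsi]
    convert zero_mul _
    rw [sub_eq_zero]
    refine LinearMap.ext fun f => ?_
    ext1 p
    simp [Word.letter_act, mul_left_comm]
  | psi_sq r i =>
    rw [map_mul, map_mul, map_mul, freeRep_fe, freeRep_fpsi]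
    have hQ := map_Q (freeRep O ε (k := k) (n := n)).toRingHom ε (i.letter (fst r))
      (i.letter (snd r)) (fy O (fst r)) (fy O (snd r))
    simp only [AlgHom.toRingHom_eq_coe, RingHom.coe_coe, freeRep_fy] at hQ
    rw [hQ]
    refine LinearMap.ext fun f => ?_
    ext1 p
    by_cases hp : p = i
    · subst hp
      have h1 := crossWeight_sq O k hε (p.letter_mem (fst r)).1 (p.letter_mem (snd r)).1
      simp only [Module.End.mul_apply, opPsi_apply, Word.letter_act, s_inv, s_fst, s_snd,
        Word.act_s_s, opIdem_apply, if_true]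
      rw [crossWeight_comm O (p.letter (snd r)), ← mul_assoc, h1, Q, if_neg (p.letter_fst_ne r)]
      by_cases h2 : |p.letter (fst r) - p.letter (snd r)| = 1
      · rw [if_pos h2, if_neg (mt (cartan_eq_zero_iff (p.letter_fst_ne r)).1 (not_not.2 h2))]
        simp only [Module.End.mul_apply, ← zsmul_one, LinearMap.smul_apply, Module.End.one_apply,
          LinearMap.sub_apply, Pi.smul_apply, Pi.sub_apply, opY_apply, opIdem_apply, if_true]
        rw [smul_mul_assoc, sub_mul]
      · rw [if_neg h2, if_pos ((cartan_eq_zero_iff (p.letter_fst_ne r)).2 h2)]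
        simp
    -- Off the word `i` both sides are zero, since `ψ_r²` and the dots return every function to the
    -- word it came from.
    · have h0 : ∀ T : Module.End (MvPolynomial ℤ O) (PolySpace O k n), (T * opIdem O i) f p = 
          T (opIdem O i f) p := fun _ => rfl
      rw [h0, Q, if_neg (i.letter_fst_ne r)]
      split_ifs with h2
      · simp [hp]
      · simp only [Module.End.mul_apply, ← zsmul_one, LinearMap.smul_apply, Module.End.one_apply,
          LinearMap.sub_apply, Pi.smul_apply, Pi.sub_apply, opY_apply, opIdem_apply, opPsi_apply,
          Word.act_s_s, hp, if_false]
        simp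
  | psi_comm r t h =>
    rw [map_mul, map_mul, freeRep_fpsi, freeRep_fpsi, opPsi_comm O r t h]
  | braid r t h i =>
    rw [if_neg (fun h' => by
      have := i.injective h'
      simp [fst, snd, Fin.ext_iff] at this
      omega), zero_mul, map_zero, map_mul, map_sub]
    simp only [map_mul, freeRep_fpsi]
    rw [opPsi_braid O r t h, sub_self, zero_mul]

variable {ε : ℤ → ℤ → ℤˣ} (hε : ∀ i j : ℤ, |i - j| = 1 → ε i j * ε j i = -1)

/-- The polynomial representation of `R_ρ`. -/
noncomputable def polyRep : KLR O ε (root k (k + n)) (n + 1) →ₐ[O]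
    Module.End (MvPolynomial ℤ O) (PolySpace O k n) :=
  RingQuot.liftAlgHom O ⟨freeRep O ε, fun _ _ h => freeRep_eq O hε h⟩

theorem polyRep_mk (x : FreeAlgebra O (Gen (root k (k + n)) (n + 1))) :
    polyRep O hε (KLR.mk O ε _ _ x) = freeRep O ε x :=
  RingQuot.liftAlgHom_mkAlgHom_apply O _ _ _

@[simp] theorem polyRep_idem (i : RootWord k n) :
    polyRep O hε (KLR.idem O ε i) = opIdem O i := by
  rw [KLR.idem, polyRep_mk, freeRep_fe]

@[simp] theorem polyRep_y (r : Fin (n + 1)) :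
    polyRep O hε (KLR.y O ε r : KLR O ε (root k (k + n)) (n + 1)) = opY O ε r := by
  rw [KLR.y, polyRep_mk, freeRep_fy]

@[simp] theorem polyRep_psi (r : Fin (n + 1 - 1)) :
    polyRep O hε (KLR.psi O ε r : KLR O ε (root k (k + n)) (n + 1)) = opPsi O r := by
  rw [KLR.psi, polyRep_mk, freeRep_fpsi]

/-- Following a colour instead of a place makes the dot weight the same on every word, so the
central element acts as a scalar. -/
theorem polyRep_dot (r : Fin (n + 1)) (f : PolySpace O k n) :
    polyRep O hε (KLR.dot O ε k r) f = dotWeight O ε k (k + (r : ℕ)) • f := by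
  classical
  ext1 i
  rw [KLR.dot, map_sum, LinearMap.sum_apply, Finset.sum_apply, Finset.sum_eq_single i]
  · simp [Word.letter_pos]
  · intro j _ hj
    simp [hj.symm]
  · simp

theorem polyRep_z (r : Fin n) (f : PolySpace O k n) :
    polyRep O hε (KLR.z O ε k r).1 f =
      (MvPolynomial.X (k + (r : ℕ)) : MvPolynomial ℤ O) ^ 2 • f := by
  rw [← dotWeight_sub O ε k (c := k + (r : ℕ)) (by omega)]
  have := KLR.coe_z' O ε k r
  rw [this, map_zsmul, map_sub, LinearMap.smul_apply, LinearMap.sub_apply, polyRep_dot,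
    polyRep_dot, smul_assoc, sub_smul]
  congr 4
  simp [add_assoc]

theorem polyRep_zmon (a : Fin n → ℕ) (f : PolySpace O k n) :
    polyRep O hε (KLR.zmon O ε k a).1 f =
      (∏ r : Fin n, (MvPolynomial.X (k + (r : ℕ)) : MvPolynomial ℤ O) ^ (2 * a r)) • f := by
  classical
  have hpow : ∀ (r : Fin n) (m : ℕ) (f : PolySpace O k n), polyRep O hε (KLR.z O ε k r ^ m).1 f =
      (MvPolynomial.X (k + (r : ℕ)) : MvPolynomial ℤ O) ^ (2 * m) • f := by
    intro r m
    induction m with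
    | zero => intro f; simp
    | succ m ih =>
      intro f
      rw [pow_succ, MulMemClass.coe_mul, map_mul, Module.End.mul_apply, polyRep_z, ih, smul_smul,
        mul_add, pow_add]
  have main : ∀ (t : Finset (Fin n)) (f : PolySpace O k n),
      polyRep O hε (∏ r ∈ t, KLR.z O ε k r ^ a r).1 f =
        (∏ r ∈ t, (MvPolynomial.X (k + (r : ℕ)) : MvPolynomial ℤ O) ^ (2 * a r)) • f := by
    intro t
    induction t using Finset.induction_on with
    | empty => intro f; simp
    | insert r t hr ih =>
      intro f
      rw [Finset.prod_insert hr, Finset.prod_insert hr, MulMemClass.coe_mul, map_mul,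
        Module.End.mul_apply, hpow, ih, smul_smul]
  exact main Finset.univ f

/-! ### The action of `ψ_w`: weighted matrix units -/

/-- The product of the weights of the pairs of neighbouring letters which are ordered differently
in two words. -/
noncomputable def crossings (i j : RootWord k n) : MvPolynomial ℤ O :=
  ∏ r : Fin n, if (i.pos r.castSucc < i.pos r.succ ↔ j.pos r.castSucc < j.pos r.succ) then 1
    else MvPolynomial.X (k + (r : ℕ))

/-- The letters `a`, `b` at the places of `q` stand in the same order in `i` and `j`, by the
hypothesis, and `s_q` reverses them in `i` alone. No other pair changes its relative order, so the
product gains just the weight of this pair. -/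
theorem crossings_act_s (i j : RootWord k n) (q : Fin (n + 1 - 1))
    (h : j.pos (i.pos⁻¹ (fst q)) < j.pos (i.pos⁻¹ (snd q))) :
    crossings O (i.act (s q)) j =
      crossWeight O (i.letter (snd q)) (i.letter (fst q)) * crossings O i j := by
  rw [i.letter_eq, i.letter_eq]
  have ha' : i.pos (i.pos⁻¹ (fst q)) = fst q := by simp
  have hb' : i.pos (i.pos⁻¹ (snd q)) = snd q := by simp
  generalize i.pos⁻¹ (fst q) = a at *
  generalize i.pos⁻¹ (snd q) = b at *
  have hq := fst_lt_snd q
  -- The weight is spread over all neighbouring pairs, at most one factor being nontrivial, so that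
  -- the identity can be checked factor by factor.
  have hw : crossWeight O (k + (b : ℕ)) (k + (a : ℕ)) =
      ∏ r : Fin n, if (a = r.castSucc ∧ b = r.succ) ∨ (a = r.succ ∧ b = r.castSucc) then
        (MvPolynomial.X (k + (r : ℕ)) : MvPolynomial ℤ O) else 1 := by
    have hal := a.is_lt
    have hbl := b.is_lt
    rw [crossWeight]
    split_ifs with hab
    · rw [Finset.prod_eq_single ⟨min a b, by
        rcases (abs_eq zero_le_one).1 hab with h' | h' <;> omega⟩]
      · rw [if_pos]
        · congr 1
          simp only
          push_cast
          omega
        · simp only [Fin.ext_iff, Fin.val_castSucc, Fin.val_succ]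
          rcases (abs_eq zero_le_one).1 hab with h' | h' <;> omega
      · intro r _ hr
        rw [if_neg]
        intro hc
        apply hr
        simp only [Fin.ext_iff, Fin.val_castSucc, Fin.val_succ] at hc ⊢
        omega
      · simp
    · refine (Finset.prod_eq_one fun r _ => if_neg fun hc => hab ?_).symm
      simp only [Fin.ext_iff, Fin.val_castSucc, Fin.val_succ] at hc
      rw [abs_eq zero_le_one]
      omega
  rw [hw, crossings, crossings, ← Finset.prod_mul_distrib]
  refine Finset.prod_congr rfl fun r _ => ?_
  rw [Word.pos_act, Equiv.Perm.mul_apply, Equiv.Perm.mul_apply]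
  by_cases h1 : a = r.castSucc ∧ b = r.succ
  · obtain ⟨rfl, rfl⟩ := h1
    simp [ha', hb', h, hq, hq.le]
  · by_cases h2 : a = r.succ ∧ b = r.castSucc
    · obtain ⟨rfl, rfl⟩ := h2
      simp [ha', hb', not_lt.2 h.le, hq, not_lt.2 hq.le]
    · rw [if_neg (not_or.2 ⟨h1, h2⟩), one_mul]
      have h3 := s_lt_s_iff (r := q) (a := i.pos r.castSucc) (b := i.pos r.succ)
        (fun hc => h1 ⟨i.pos.injective (by rw [ha', hc.1]), i.pos.injective (by rw [hb', hc.2])⟩)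
        (fun hc => h2 ⟨i.pos.injective (by rw [ha', hc.2]), i.pos.injective (by rw [hb', hc.1])⟩)
      simp only [h3]

-- Induction along the weak order: each step is an ascent, so the two strands it crosses have not
-- crossed before and the weights multiply without repetition.
open Classical in
theorem polyRep_psiPerm (w : Equiv.Perm (Fin (n + 1))) (j : RootWord k n) (f : PolySpace O k n)
    (i : RootWord k n) : polyRep O hε (KLR.psiPerm O ε _ w * KLR.idem O ε j) f i =
      if i = j.act w then crossings O i j * f j else 0 := by
  induction w using perm_induction generalizing i with
  | one =>
    rw [KLR.psiPerm_one, one_mul, polyRep_idem, opIdem_apply, Word.act_one]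
    split_ifs with h
    · subst h; simp [crossings]
    · rfl
  | step q w h ih =>
    rw [← KLR.psi_mul_psiPerm O ε h, mul_assoc, map_mul, Module.End.mul_apply, polyRep_psi,
      opPsi_apply, ih, Word.act_mul, Word.act_s_eq_iff]
    split_ifs with hi
    · subst hi
      rw [Word.act_s_s, crossings_act_s, Word.letter_act _ (s q), Word.letter_act _ (s q), s_inv,
        s_fst, s_snd, mul_assoc]
      rw [Word.pos_act]
      simpa using h
    · rw [mul_zero]

open Classical in
theorem polyRep_stdElem (a : Fin n → ℕ) (w : Equiv.Perm (Fin (n + 1))) (j : RootWord k n)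
    (f : PolySpace O k n) (i : RootWord k n) :
    polyRep O hε (KLR.stdElem O ε k a w j) f i =
      if i = j.act w then
        (∏ r : Fin n, (MvPolynomial.X (k + (r : ℕ)) : MvPolynomial ℤ O) ^ (2 * a r)) *
          crossings O i j * f j else 0 := by
  rw [KLR.stdElem, map_mul, Module.End.mul_apply, polyRep_zmon, Pi.smul_apply, polyRep_psiPerm]
  split_ifs <;> simp [mul_assoc]

open Classical in
/-- The polynomial representation by matrices. -/
noncomputable def matRep : KLR O ε (root k (k + n)) (n + 1) →ₐ[O]
    Matrix (RootWord k n) (RootWord k n) (MvPolynomial ℤ O) :=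
  (LinearMap.toMatrixAlgEquiv'.toAlgHom.restrictScalars O).comp (polyRep O hε)

open Classical in
theorem matRep_apply (x : KLR O ε (root k (k + n)) (n + 1)) (i j : RootWord k n) :
    matRep O hε x i j = polyRep O hε x (Pi.single j 1) i := by
  change LinearMap.toMatrix' (polyRep O hε x) i j = _
  rw [LinearMap.toMatrix'_apply]

end Representation

/-! ### Signs of skew shapes -/

/-- The shift moves everything on one side of the step from box `r` to the next rigidly, so only
that step changes direction. -/
theorem SkewDiagram.sign_split {k : ℤ} {n : ℕ} (S : SkewDiagram k n) (r t : Fin n) :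
    (S.split r).sign t = if t = r then !(S.sign r) else S.sign t := by
  have l1 : (t.succ ≤ r.castSucc) ↔ (t : ℕ) < r := by rw [Fin.le_def]; simp
  have l2 : (t.castSucc ≤ r.castSucc) ↔ (t : ℕ) ≤ r := by rw [Fin.le_def]; simp
  have l3 : t = r ↔ (t : ℕ) = r := Fin.ext_iff
  have h1 := S.sign_eq_true_iff r
  have h2 := S.sign_eq_true_iff t
  have h3 := S.box_step r
  rw [Bool.eq_iff_iff, SkewDiagram.sign_eq_true_iff, SkewDiagram.split, SkewDiagram.box_ofPath,
    SkewDiagram.box_ofPath]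
  by_cases htr : t = r
  · subst htr
    simp only [l1, l2, lt_irrefl, le_refl, if_true, if_false]
    split_ifs with h
    · have := h1.1 h
      simp [h, diag]
      omega
    · have := mt h1.2 h
      simp [h, diag]
      omega
  · rw [if_neg htr, h2]
    have htr' : (t : ℕ) ≠ r := fun h => htr (l3.2 h)
    simp only [l1, l2]
    split_ifs <;> simp only [diag] <;> omega

namespace Shape

variable {k : ℤ} {n : ℕ}

theorem sign_sp (r : Fin n) (S : Shape k n) :
    (sp r S).sign = Function.update S.sign r (!(S.sign r)) := by
  induction S using Quotient.inductionOn with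
  | _ S =>
    funext t
    rw [Function.update_apply]
    exact S.sign_split r t

/-- The link between shapes and the polynomial representation: comparing the signs of two shapes
amounts to comparing the order of neighbouring letters in their words. -/
theorem sign_eq_true_iff (S : Shape k n) (r : Fin n) :
    S.sign r = true ↔ S.word.pos r.castSucc < S.word.pos r.succ := by
  induction S using Quotient.inductionOn with
  | _ S =>
    change S.sign r = true ↔ S.word.pos r.castSucc < S.word.pos r.succ
    refine (S.sign_eq_true_iff_word r).trans ⟨fun h => h _ _ ?_ ?_, fun h p q hp hq => ?_⟩
    · exact Word.letter_pos _ _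
    · refine (Word.letter_pos _ _).trans ?_
      simp [add_assoc]
    · rwa [S.word.injective (hp.trans (S.word.letter_pos r.castSucc).symm),
        S.word.injective (hq.trans (by simp [Word.letter_pos, add_assoc] :
          _ = S.word.letter (S.word.pos r.succ)))]

instance : Nonempty (Shape k n) :=
  -- A single row, placed low enough that a negative first content `k` still gives a natural column.
  ⟨Quotient.mk _ (SkewDiagram.ofPath (fun t => ((-k).toNat, ((-k).toNat + k).toNat + t))
    (fun t => by simp only [content]; omega) fun r => Or.inl rfl)⟩

noncomputable instance : DecidableEq (Shape k n) := Classical.decEq _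

/-- Starting from any shape, each wrong sign is corrected by one `sp`, which leaves the others
alone. -/
theorem sign_surjective : Function.Surjective (sign (k := k) (n := n)) := by
  intro σ
  have main : ∀ s : Finset (Fin n), ∃ S : Shape k n, ∀ r ∈ s, S.sign r = σ r := by
    intro s
    induction s using Finset.induction_on with
    | empty => exact ⟨Classical.arbitrary _, by simp⟩
    | insert t s ht ih =>
      obtain ⟨S, hS⟩ := ih
      by_cases h : S.sign t = σ t
      · exact ⟨S, by simpa [h] using hS⟩
      · refine ⟨sp t S, fun r hr => ?_⟩
        rw [sign_sp, Function.update_apply]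
        split_ifs with hrt
        · subst hrt
          cases h1 : S.sign r <;> cases h2 : σ r <;> simp_all
        · exact hS r (Finset.mem_of_mem_insert_of_ne hr hrt)
  obtain ⟨S, hS⟩ := main Finset.univ
  exact ⟨S, funext fun r => hS r (Finset.mem_univ r)⟩

/-- Shapes correspond to sign vectors. -/
noncomputable def signEquiv : Shape k n ≃ (Fin n → Bool) :=
  Equiv.ofBijective sign ⟨sign_injective, sign_surjective⟩

theorem act_perm (S T : Shape k n) : T.word.act (S.perm T) = S.word :=
  (existsUnique_act_eq S.word T.word).choose_spec.1

theorem perm_eq {S T : Shape k n} {w : Equiv.Perm (Fin (n + 1))} (h : T.word.act w = S.word) :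
    S.perm T = w :=
  ((existsUnique_act_eq S.word T.word).choose_spec.2 w h).symm

end Shape

/-! ### The representation of `e R'_ρ e` -/

section Corner

variable (O : Type*) [CommRing O] {k : ℤ} {n : ℕ}

/-- The exponents of the weight attached to `z^a ψ(λ, μ)`. -/
noncomputable def shapeExp (a : Fin n → ℕ) (S T : Shape k n) (r : Fin n) : ℕ :=
  2 * a r + if S.sign r = T.sign r then 0 else 1

/-- The weight attached to `z^a ψ(λ, μ)`. -/
noncomputable def shapeWeight (a : Fin n → ℕ) (S T : Shape k n) : MvPolynomial ℤ O :=
  ∏ r : Fin n, MvPolynomial.X (k + (r : ℕ)) ^ shapeExp a S T r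

theorem crossings_word (S T : Shape k n) :
    crossings O S.word T.word = ∏ r : Fin n, (MvPolynomial.X (k + (r : ℕ)) : MvPolynomial ℤ O) ^
      (if S.sign r = T.sign r then 0 else 1) := by
  refine Finset.prod_congr rfl fun r _ => ?_
  simp only [← Shape.sign_eq_true_iff, ← Bool.eq_iff_iff]
  split_ifs <;> simp

theorem prod_mul_crossings (a : Fin n → ℕ) (S T : Shape k n) :
    (∏ r : Fin n, (MvPolynomial.X (k + (r : ℕ)) : MvPolynomial ℤ O) ^ (2 * a r)) *
      crossings O S.word T.word = shapeWeight O a S T := by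
  rw [crossings_word, ← Finset.prod_mul_distrib, shapeWeight]
  exact Finset.prod_congr rfl fun r _ => (pow_add _ _ _).symm

variable (ε : ℤ → ℤ → ℤˣ)

theorem incl_injective : Function.Injective (eRe.incl O ε k n) :=
  fun _ _ h => Subtype.ext (Subtype.ext h)

theorem incl_mul (x y : eRe O ε k n) :
    eRe.incl O ε k n (x * y) = eRe.incl O ε k n x * eRe.incl O ε k n y := rfl

theorem coe_e : ((e O ε k n : KLR.R' O ε (root k (k + n)) (n + 1)) :
    KLR O ε (root k (k + n)) (n + 1)) = ∑ S : Shape k n, KLR.idem O ε S.word := by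
  rw [e, AddSubmonoidClass.coe_finsetSum]
  rfl

theorem incl_one : eRe.incl O ε k n 1 = ∑ S : Shape k n, KLR.idem O ε S.word :=
  coe_e O ε

theorem sum_idem_mul_incl (x : eRe O ε k n) :
    (∑ S : Shape k n, KLR.idem O ε S.word) * eRe.incl O ε k n x = eRe.incl O ε k n x := by
  rw [← incl_one, ← incl_mul, one_mul]

theorem incl_mul_sum_idem (x : eRe O ε k n) :
    eRe.incl O ε k n x * (∑ S : Shape k n, KLR.idem O ε S.word) = eRe.incl O ε k n x := by
  rw [← incl_one, ← incl_mul, mul_one]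

variable {O ε}

theorem sum_idem_mul_idem (T : Shape k n) :
    (∑ S : Shape k n, KLR.idem O ε S.word) * KLR.idem O ε T.word = KLR.idem O ε T.word := by
  classical
  rw [Finset.sum_mul, Finset.sum_eq_single T]
  · rw [KLR.idem_mul_self]
  · intro S _ hS
    rw [KLR.idem_mul_idem, if_neg fun h => hS (Shape.word_injective h)]
  · simp

theorem idem_mul_sum_idem (T : Shape k n) :
    KLR.idem O ε T.word * (∑ S : Shape k n, KLR.idem O ε S.word) = KLR.idem O ε T.word := by
  classical
  rw [Finset.mul_sum, Finset.sum_eq_single T]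
  · rw [KLR.idem_mul_self]
  · intro S _ hS
    rw [KLR.idem_mul_idem, if_neg fun h => hS (Shape.word_injective h).symm]
  · simp

theorem sum_idem_mul_idem_of_ne {i : RootWord k n} (h : ∀ S : Shape k n, S.word ≠ i) :
    (∑ S : Shape k n, KLR.idem O ε S.word) * KLR.idem O ε i = 0 := by
  classical
  rw [Finset.sum_mul]
  exact Finset.sum_eq_zero fun S _ => by rw [KLR.idem_mul_idem, if_neg (h S)]

theorem idem_mul_sum_idem_of_ne {i : RootWord k n} (h : ∀ S : Shape k n, S.word ≠ i) :
    KLR.idem O ε i * (∑ S : Shape k n, KLR.idem O ε S.word) = 0 := by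
  classical
  rw [Finset.mul_sum]
  exact Finset.sum_eq_zero fun S _ => by rw [KLR.idem_mul_idem, if_neg (h S).symm]

open Classical in
theorem matRep_idem (hε : ∀ i j : ℤ, |i - j| = 1 → ε i j * ε j i = -1) (i p q : RootWord k n) :
    matRep O hε (KLR.idem O ε i) p q = if p = i ∧ p = q then 1 else 0 := by
  rw [matRep_apply, polyRep_idem, opIdem_apply, Pi.single_apply, ite_and]

open Classical in
/-- The representation of `e R'_ρ e` by matrices. -/
noncomputable def cornerRep (hε : ∀ i j : ℤ, |i - j| = 1 → ε i j * ε j i = -1) :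
    eRe O ε k n →ₐ[O] Matrix (Shape k n) (Shape k n) (MvPolynomial ℤ O) :=
  AlgHom.ofLinearMap
    { toFun := fun x => (matRep O hε (eRe.incl O ε k n x)).submatrix Shape.word Shape.word
      map_add' := fun x y => by rw [map_add, map_add]; rfl
      map_smul' := fun c x => by rw [map_smul, map_smul]; rfl }
    (by
      ext1 S T
      change matRep O hε (eRe.incl O ε k n 1) S.word T.word = _
      rw [incl_one, map_sum, Matrix.sum_apply, Matrix.one_apply]
      simp [matRep_idem, Shape.word_injective.eq_iff, ite_and])
    (by
      intro x y
      ext1 S T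
      change matRep O hε (eRe.incl O ε k n (x * y)) S.word T.word = _
      rw [incl_mul, map_mul, Matrix.mul_apply, Matrix.mul_apply]
      symm
      -- Restriction to the words of shapes is multiplicative because `y = e y`: the rows of `y` at
      -- all other words vanish.
      refine Finset.sum_of_injOn Shape.word Shape.word_injective.injOn
        (fun _ _ => Finset.mem_coe.2 (Finset.mem_univ _))
        (fun i _ hi => ?_) fun _ _ => rfl
      convert mul_zero _
      rw [← sum_idem_mul_incl, map_mul, map_sum, Matrix.mul_apply]
      refine Finset.sum_eq_zero fun j _ => ?_
      convert zero_mul _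
      rw [Matrix.sum_apply]
      refine Finset.sum_eq_zero fun U _ => ?_
      rw [matRep_idem, if_neg]
      rintro ⟨rfl, -⟩
      exact hi ⟨U, Finset.mem_coe.2 (Finset.mem_univ _), rfl⟩)

theorem cornerRep_apply (hε : ∀ i j : ℤ, |i - j| = 1 → ε i j * ε j i = -1) (x : eRe O ε k n)
    (S T : Shape k n) :
    cornerRep hε x S T = matRep O hε (eRe.incl O ε k n x) S.word T.word := rfl

/-! ### Standard elements of the corner, their matrices and their span -/

variable (O ε)

theorem y_sub_y_mem (p q : Fin (n + 1)) :
    (KLR.y O ε p - KLR.y O ε q : KLR O ε (root k (k + n)) (n + 1)) ∈ KLR.R' O ε _ _ := by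
  have main : ∀ p : Fin (n + 1), (KLR.y O ε p - KLR.y O ε 0 : KLR O ε (root k (k + n)) (n + 1)) ∈
      KLR.R' O ε (root k (k + n)) (n + 1) := by
    intro p
    induction p using Fin.induction with
    | zero => rw [sub_self]; exact zero_mem _
    | succ r ih =>
      have h : (KLR.y O ε r.castSucc - KLR.y O ε r.succ : KLR O ε (root k (k + n)) (n + 1)) ∈
          KLR.R' O ε (root k (k + n)) (n + 1) :=
        Algebra.subset_adjoin (Or.inl (Or.inr ⟨r, rfl⟩))
      have := sub_mem ih h
      rwa [sub_sub_sub_cancel_left] at this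
  have := sub_mem (main p) (main q)
  rwa [sub_sub_sub_cancel_right] at this

theorem idem_mem (i : RootWord k n) : KLR.idem O ε i ∈ KLR.R' O ε (root k (k + n)) (n + 1) :=
  Algebra.subset_adjoin (Or.inl (Or.inl ⟨i, rfl⟩))

/-- On each idempotent `z_r` is a difference of two dots, which telescopes into the generators `y_p
- y_{p+1}`. A single dot `x_r` need not lie in `R'_ρ`. -/
theorem z_mem (r : Fin n) : (KLR.z O ε k r).1 ∈ KLR.R' O ε (root k (k + n)) (n + 1) := by
  have := KLR.coe_z' O ε k r
  rw [this]
  refine zsmul_mem ?_ _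
  rw [KLR.dot, KLR.dot, ← Finset.sum_sub_distrib]
  refine sum_mem fun i _ => ?_
  rw [← sub_mul]
  exact mul_mem (y_sub_y_mem O ε _ _) (idem_mem O ε i)

theorem psiPerm_mem (w : Equiv.Perm (Fin (n + 1))) :
    KLR.psiPerm O ε _ w ∈ KLR.R' O ε (root k (k + n)) (n + 1) := by
  refine list_prod_mem fun x hx => ?_
  obtain ⟨r, -, rfl⟩ := List.mem_map.1 hx
  exact Algebra.subset_adjoin (Or.inr ⟨r, rfl⟩)

theorem zmon_mem (a : Fin n → ℕ) : (KLR.zmon O ε k a).1 ∈ KLR.R' O ε (root k (k + n)) (n + 1) := by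
  suffices h : KLR.zmon O ε k a ∈
      (KLR.R' O ε (root k (k + n)) (n + 1)).comap (Subalgebra.center O _).val from h
  exact prod_mem fun r _ => pow_mem (z_mem O ε r) _

theorem stdElem_mem_R' (a : Fin n → ℕ) (w : Equiv.Perm (Fin (n + 1))) (i : RootWord k n) :
    KLR.stdElem O ε k a w i ∈ KLR.R' O ε (root k (k + n)) (n + 1) :=
  mul_mem (zmon_mem O ε a) (mul_mem (psiPerm_mem O ε w) (idem_mem O ε i))

theorem stdElem_mul_idem (a : Fin n → ℕ) (w : Equiv.Perm (Fin (n + 1))) (i : RootWord k n) :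
    KLR.stdElem O ε k a w i * KLR.idem O ε i = KLR.stdElem O ε k a w i := by
  rw [KLR.stdElem, mul_assoc, mul_assoc, KLR.idem_mul_self]

/-- The element `z^a ψ(λ, μ) 1_{i^μ}` of `e R'_ρ e`. -/
noncomputable def cornerElem (a : Fin n → ℕ) (S T : Shape k n) : eRe O ε k n :=
  ⟨⟨KLR.stdElem O ε k a (S.perm T) T.word, stdElem_mem_R' O ε _ _ _⟩, by
    refine (Subsemigroup.mem_corner_iff (e_idem O ε k n)).2 ⟨?_, ?_⟩
    · apply Subtype.ext
      change (e O ε k n).1 * KLR.stdElem O ε k a (S.perm T) T.word =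
        KLR.stdElem O ε k a (S.perm T) T.word
      rw [coe_e, ← KLR.idem_mul_stdElem, Shape.act_perm, ← mul_assoc, sum_idem_mul_idem]
    · apply Subtype.ext
      change KLR.stdElem O ε k a (S.perm T) T.word * (e O ε k n).1 =
        KLR.stdElem O ε k a (S.perm T) T.word
      rw [coe_e, ← stdElem_mul_idem, mul_assoc, idem_mul_sum_idem]⟩

theorem incl_cornerElem (a : Fin n → ℕ) (S T : Shape k n) :
    eRe.incl O ε k n (cornerElem O ε a S T) = KLR.stdElem O ε k a (S.perm T) T.word := rfl

open Classical in
theorem cornerRep_cornerElem (hε : ∀ i j : ℤ, |i - j| = 1 → ε i j * ε j i = -1)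
    (a : Fin n → ℕ) (S T : Shape k n) :
    cornerRep hε (cornerElem O ε a S T) = Matrix.single S T (shapeWeight O a S T) := by
  ext1 U V
  rw [cornerRep_apply, matRep_apply, incl_cornerElem, polyRep_stdElem, Shape.act_perm,
    Matrix.single_apply, Pi.single_apply]
  simp only [Shape.word_injective.eq_iff]
  by_cases h1 : U = S
  · subst h1
    by_cases h2 : T = V
    · simp [h2, prod_mul_crossings]
    · simp [h2]
  · rw [if_neg h1, if_neg fun h => h1 h.1.symm]

/-- Cutting `z^a ψ_w 1_i` by `e` on both sides leaves it unchanged when `i` and `w·i` are both words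
of shapes, and kills it otherwise. -/
theorem span_cornerElem (hε : ∀ i j : ℤ, |i - j| = 1 → ε i j * ε j i = -1) :
    Submodule.span O (Set.range fun p : (Fin n → ℕ) × Shape k n × Shape k n =>
      cornerElem O ε p.1 p.2.1 p.2.2) = ⊤ := by
  rw [eq_top_iff]
  rintro x -
  set N := Submodule.span O (Set.range fun p : (Fin n → ℕ) × Shape k n × Shape k n =>
      cornerElem O ε p.1 p.2.1 p.2.2)
  have key : ∀ v ∈ KLR.stdSpan O ε k n, (∑ S : Shape k n, KLR.idem O ε S.word) * v *
      (∑ S : Shape k n, KLR.idem O ε S.word) ∈ N.map (eRe.incl O ε k n) := by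
    intro v hv
    induction hv using Submodule.span_induction with
    | mem v hv =>
      obtain ⟨⟨a, w, i⟩, rfl⟩ := hv
      simp only
      by_cases h1 : ∃ T : Shape k n, T.word = i
      · obtain ⟨T, rfl⟩ := h1
        by_cases h2 : ∃ S : Shape k n, S.word = T.word.act w
        · obtain ⟨S, hS⟩ := h2
          refine ⟨cornerElem O ε a S T, Submodule.subset_span ⟨(a, S, T), rfl⟩, ?_⟩
          rw [← incl_one, incl_cornerElem, Shape.perm_eq hS.symm, ← Shape.perm_eq hS.symm,
            ← incl_cornerElem, ← incl_mul, ← incl_mul, one_mul, mul_one]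
        · push Not at h2
          rw [← KLR.idem_mul_stdElem, ← mul_assoc, sum_idem_mul_idem_of_ne h2, zero_mul, zero_mul]
          exact zero_mem _
      · push Not at h1
        rw [← stdElem_mul_idem, mul_assoc, mul_assoc, idem_mul_sum_idem_of_ne h1, mul_zero,
          mul_zero]
        exact zero_mem _
    | zero => simp
    | add v v' _ _ hv hv' => rw [mul_add, add_mul]; exact add_mem hv hv'
    | smul c v _ hv => rw [mul_smul_comm, smul_mul_assoc]; exact Submodule.smul_mem _ _ hv
  have hx := key _ (KLR.R'_le_stdSpan O k hε x.1.2)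
  change _ * eRe.incl O ε k n x * _ ∈ _ at hx
  rw [sum_idem_mul_incl, incl_mul_sum_idem] at hx
  obtain ⟨y, hy, hxy⟩ := hx
  rwa [← incl_injective O ε hxy]

end Corner

/-! ### The representation of `B_n` -/

section BRep

variable (O : Type*) [CommRing O]

theorem B.mk_eq {x y : FreeAlgebra O BGen} (h : BRel O x y) : B.mk O x = B.mk O y :=
  RingQuot.mkAlgHom_rel O h

theorem B.e_mul_e (s t : Bool) : B.e O s * B.e O t = if s = t then B.e O s else 0 := by
  split_ifs with h
  · subst h
    simpa [B.e] using B.mk_eq O (BRel.idem s)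
  · obtain rfl : t = !s := by cases s <;> cases t <;> simp_all
    simpa [B.e] using B.mk_eq O (BRel.orth s)

theorem B.sum_e : B.e O true + B.e O false = 1 := by
  simpa [B.e] using B.mk_eq O BRel.sum

theorem B.e_mul_b (s : Bool) : B.e O s * B.b O = B.b O * B.e O (!s) := by
  simpa [B.e, B.b] using B.mk_eq O (BRel.comm s)

theorem B.e_mul_b_pow (s : Bool) (m : ℕ) : ∃ t, B.e O s * B.b O ^ m = B.b O ^ m * B.e O t := by
  induction m with
  | zero => exact ⟨s, by simp⟩
  | succ m ih =>
    obtain ⟨t, ht⟩ := ih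
    exact ⟨!t, by rw [pow_succ, ← mul_assoc, ht, mul_assoc, B.e_mul_b, mul_assoc]⟩

/-- Idempotents move past powers of `b`, so this span is stable under left multiplication by the
generators, and it contains 1. -/
theorem B.span_eq_top :
    Submodule.span O (Set.range fun p : ℕ × Bool => B.b O ^ p.1 * B.e O p.2) = ⊤ := by
  rw [eq_top_iff]
  rintro x -
  set N := Submodule.span O (Set.range fun p : ℕ × Bool => B.b O ^ p.1 * B.e O p.2)
  have h1 : (1 : B O) ∈ N := by
    rw [← B.sum_e]
    exact add_mem (Submodule.subset_span ⟨(0, true), by simp⟩)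
      (Submodule.subset_span ⟨(0, false), by simp⟩)
  suffices h : ∀ v ∈ N, x * v ∈ N by simpa using h 1 h1
  obtain ⟨x, rfl⟩ : ∃ x', B.mk O x' = x := RingQuot.mkAlgHom_surjective O _ x
  induction x using FreeAlgebra.induction with
  | grade0 c =>
    intro v hv
    rw [AlgHom.commutes, ← Algebra.smul_def]
    exact N.smul_mem c hv
  | grade1 g =>
    intro v hv
    induction hv using Submodule.span_induction with
    | mem v hv =>
      obtain ⟨⟨m, t⟩, rfl⟩ := hv
      cases g with
      | e s =>
        obtain ⟨u, hu⟩ := B.e_mul_b_pow O s m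
        change B.e O s * (B.b O ^ m * B.e O t) ∈ N
        rw [← mul_assoc, hu, mul_assoc, B.e_mul_e]
        split_ifs with h
        · subst h
          exact Submodule.subset_span ⟨(m, u), rfl⟩
        · simp
      | b =>
        refine Submodule.subset_span ⟨(m + 1, t), ?_⟩
        change B.b O ^ (m + 1) * B.e O t = B.b O * (B.b O ^ m * B.e O t)
        rw [pow_succ', mul_assoc]
    | zero => simp
    | add v v' _ _ hv hv' => rw [mul_add]; exact add_mem hv hv'
    | smul c v _ hv => rw [mul_smul_comm]; exact N.smul_mem c hv
  | mul a b ha hb =>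
    intro v hv
    rw [map_mul, mul_assoc]
    exact ha _ (hb v hv)
  | add a b ha hb =>
    intro v hv
    rw [map_add, add_mul]
    exact add_mem (ha v hv) (hb v hv)

/-- The matrix of `b`. -/
noncomputable def bMat (c : ℤ) : Matrix Bool Bool (MvPolynomial ℤ O) :=
  Matrix.of fun s t => if s = t then 0 else MvPolynomial.X c

/-- The matrices of the generators of `B`. -/
noncomputable def bGenMat (c : ℤ) : BGen → Matrix Bool Bool (MvPolynomial ℤ O)
  | .e s => Matrix.single s s 1
  | .b => bMat O c

/-- The representation of `B` by matrices. -/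
noncomputable def B.rep (c : ℤ) : B O →ₐ[O] Matrix Bool Bool (MvPolynomial ℤ O) :=
  RingQuot.liftAlgHom O ⟨FreeAlgebra.lift O (bGenMat O c), by
    intro x y h
    cases h with
    | orth s => cases s <;> simp [bGenMat]
    | idem s => simp [bGenMat]
    | sum =>
      ext1 s t
      cases s <;> cases t <;> simp [bGenMat]
    | comm s =>
      simp only [map_mul, FreeAlgebra.lift_ι_apply, bGenMat]
      ext1 t u
      cases s <;> cases t <;> cases u <;>
        simp [bMat, Matrix.single_apply, Matrix.mul_apply]⟩

@[simp] theorem B.rep_e (c : ℤ) (s : Bool) : B.rep O c (B.e O s) = Matrix.single s s 1 := by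
  refine (RingQuot.liftAlgHom_mkAlgHom_apply O _ _ _).trans ?_
  simp [bGenMat]

@[simp] theorem B.rep_b (c : ℤ) : B.rep O c (B.b O) = bMat O c := by
  refine (RingQuot.liftAlgHom_mkAlgHom_apply O _ _ _).trans ?_
  simp [bGenMat]

theorem bMat_sq (c : ℤ) : bMat O c * bMat O c = (MvPolynomial.X c ^ 2 : MvPolynomial ℤ O) • 1 := by
  ext1 s t
  cases s <;> cases t <;> simp [bMat, Matrix.mul_apply, sq]

/-- The matrix of `b` squares to the scalar `X²`, so only the parity of the exponent decides whether
the sign is switched. -/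
theorem B.rep_std (c : ℤ) (a : ℕ) (s t : Bool) :
    B.rep O c (B.b O ^ (2 * a + if s = t then 0 else 1) * B.e O t) =
      Matrix.single s t (MvPolynomial.X c ^ (2 * a + if s = t then 0 else 1)) := by
  rw [map_mul, map_pow, B.rep_e, B.rep_b, pow_add, pow_mul, sq, bMat_sq, smul_pow, one_pow,
    smul_mul_assoc, one_mul, smul_mul_assoc, ← pow_mul, pow_add]
  ext1 u v
  cases s <;> cases t <;> cases u <;> cases v <;>
    simp [bMat, Matrix.single_apply, Matrix.mul_apply]

/-- The elements `b^m e(t)` indexed by both end vertices: the parity of `m` is equivalent to the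
choice of the end vertex `s`. This indexing matches pairs of shapes. -/
theorem B.span_std :
    Submodule.span O (Set.range fun p : ℕ × Bool × Bool =>
      B.b O ^ (2 * p.1 + if p.2.1 = p.2.2 then 0 else 1) * B.e O p.2.2) = ⊤ := by
  rw [eq_top_iff, ← B.span_eq_top, Submodule.span_le]
  rintro _ ⟨⟨m, t⟩, rfl⟩
  refine Submodule.subset_span ⟨(m / 2, if m % 2 = 0 then t else !t, t), ?_⟩
  simp only
  congr 2
  split_ifs with h1 h2 h2
  · omega
  · exact absurd rfl h2
  · simp at h2
  · omega

/-! ### Matrices for the tensor power, indexed by shapes -/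

variable (k : ℤ) (n : ℕ)

/-- A matrix coefficient of the representation of `B_n`. -/
noncomputable def Bn.entry (S T : Shape k n) :
    MultilinearMap O (fun _ : Fin n => B O) (MvPolynomial ℤ O) :=
  (MultilinearMap.mkPiAlgebra O (Fin n) (MvPolynomial ℤ O)).compLinearMap fun r =>
    (Matrix.entryLinearMap O (MvPolynomial ℤ O) (S.sign r) (T.sign r)).comp
      (B.rep O (k + (r : ℕ))).toLinearMap

theorem Bn.entry_apply (S T : Shape k n) (x : Fin n → B O) :
    Bn.entry O k n S T x = ∏ r : Fin n, B.rep O (k + (r : ℕ)) (x r) (S.sign r) (T.sign r) := rfl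

/-- The representation of `B_n` by matrices. -/
noncomputable def Bn.rep :
    Bn O n →ₐ[O] Matrix (Shape k n) (Shape k n) (MvPolynomial ℤ O) :=
  PiTensorProduct.liftAlgHom
    { toFun := fun x => Matrix.of fun S T => Bn.entry O k n S T x
      map_update_add' := fun x r a b => by
        ext1 S T
        exact (Bn.entry O k n S T).map_update_add x r a b
      map_update_smul' := fun x r c a => by
        ext1 S T
        exact (Bn.entry O k n S T).map_update_smul x r c a }
    (by
      ext1 S T
      change Bn.entry O k n S T 1 = _
      simp only [Bn.entry_apply, Pi.one_apply, map_one, Matrix.one_apply]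
      by_cases h : S = T
      · simp [h]
      · rw [if_neg h]
        obtain ⟨r, hr⟩ := Function.ne_iff.1 fun h' => h (Shape.sign_injective h')
        exact Finset.prod_eq_zero (Finset.mem_univ r) (if_neg hr))
    (by
      intro x y
      ext1 S T
      change Bn.entry O k n S T (x * y) = ∑ U, Bn.entry O k n S U x * Bn.entry O k n U T y
      simp only [Bn.entry_apply, Pi.mul_apply, map_mul, Matrix.mul_apply, Finset.prod_univ_sum,
        Fintype.piFinset_univ, ← Finset.prod_mul_distrib]
      -- A product of two-term sums expands into a sum over sign vectors, which are the intermediate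
      -- shapes of the matrix product.
      exact (Equiv.sum_comp Shape.signEquiv fun σ : Fin n → Bool => ∏ r : Fin n,
        B.rep O (k + (r : ℕ)) (x r) (S.sign r) (σ r) *
          B.rep O (k + (r : ℕ)) (y r) (σ r) (T.sign r)).symm)

variable {n}

theorem Bn.rep_tprod (x : Fin n → B O) (S T : Shape k n) :
    Bn.rep O k n (PiTensorProduct.tprod O x) S T =
      ∏ r : Fin n, B.rep O (k + (r : ℕ)) (x r) (S.sign r) (T.sign r) := by
  rw [Bn.rep, PiTensorProduct.liftAlgHom_apply, PiTensorProduct.lift.tprod]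
  rfl

variable {k}

/-- The element of `B_n` corresponding to `z^a ψ(λ, μ)`. -/
noncomputable def Bn.std (a : Fin n → ℕ) (S T : Shape k n) : Bn O n :=
  PiTensorProduct.tprod O fun r => B.b O ^ shapeExp a S T r * B.e O (T.sign r)

theorem Bn.rep_std (a : Fin n → ℕ) (S T : Shape k n) :
    Bn.rep O k n (Bn.std O a S T) = Matrix.single S T (shapeWeight O a S T) := by
  ext1 U V
  rw [Bn.std, Bn.rep_tprod]
  simp only [shapeExp, B.rep_std, Matrix.single_apply]
  split_ifs with h
  · obtain ⟨rfl, rfl⟩ := h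
    simp [shapeWeight, shapeExp]
  · by_cases hS : S = U
    · have hT : T ≠ V := fun hT => h ⟨hS, hT⟩
      obtain ⟨r, hr⟩ := Function.ne_iff.1 fun h' => hT (Shape.sign_injective h')
      exact Finset.prod_eq_zero (Finset.mem_univ r) (if_neg fun hc => hr hc.2)
    · obtain ⟨r, hr⟩ := Function.ne_iff.1 fun h' => hS (Shape.sign_injective h')
      exact Finset.prod_eq_zero (Finset.mem_univ r) (if_neg fun hc => hr hc.1)

-- Pure tensors of spanning vectors span, and choosing a pair of signs in every factor is choosing a
-- pair of shapes.
variable (k) in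
theorem Bn.span_std :
    Submodule.span O (Set.range fun p : (Fin n → ℕ) × Shape k n × Shape k n =>
      Bn.std O p.1 p.2.1 p.2.2) = ⊤ := by
  rw [eq_top_iff, ← PiTensorProduct.submodule_span_eq_top (fun _ : Fin n => B.span_std O),
    Submodule.span_le]
  rintro _ ⟨j, rfl⟩
  obtain ⟨S, hS⟩ := Shape.sign_surjective (k := k) fun r => (j r).2.1
  obtain ⟨T, hT⟩ := Shape.sign_surjective (k := k) fun r => (j r).2.2
  refine Submodule.subset_span ⟨(fun r => (j r).1, S, T), ?_⟩
  simp only [Bn.std, shapeExp, hS, hT]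

theorem Bn.std_self (S : Shape k n) : Bn.std O 0 S S = Bn.e O S.sign := by
  simp [Bn.std, Bn.e, shapeExp]

theorem Bn.std_sp (S : Shape k n) (r : Fin n) :
    Bn.std O 0 (S.sp r) S = Bn.b O r * Bn.e O S.sign := by
  rw [Bn.b, Bn.e, PiTensorProduct.tprod_mul_tprod, Bn.std]
  congr 1
  funext t
  rw [Pi.mul_apply, shapeExp, Shape.sign_sp, Function.update_apply]
  by_cases h : t = r
  · subst h; simp
  · simp [h]

end BRep

/-! ### Linear independence of the weighted matrix units -/

section Independence

variable (O : Type*) [CommRing O] {k : ℤ} {n : ℕ}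

/-- The exponent vector of the weight attached to `z^a ψ(λ, μ)`. -/
noncomputable def shapeExponent (a : Fin n → ℕ) (S T : Shape k n) : ℤ →₀ ℕ :=
  ∑ r : Fin n, Finsupp.single (k + (r : ℕ)) (shapeExp a S T r)

theorem shapeWeight_eq_monomial (a : Fin n → ℕ) (S T : Shape k n) :
    shapeWeight O a S T = MvPolynomial.monomial (shapeExponent a S T) 1 := by
  rw [shapeExponent, MvPolynomial.monomial_sum_one, shapeWeight]
  exact Finset.prod_congr rfl fun r _ => MvPolynomial.X_pow_eq_monomial

theorem shapeExponent_apply (a : Fin n → ℕ) (S T : Shape k n) (r : Fin n) :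
    shapeExponent a S T (k + (r : ℕ)) = shapeExp a S T r := by
  rw [shapeExponent, Finsupp.finsetSum_apply, Finset.sum_eq_single r]
  · simp
  · intro t _ ht
    rw [Finsupp.single_apply, if_neg]
    intro h
    exact ht (Fin.ext (by omega))
  · simp

theorem shapeExponent_injective {a a' : Fin n → ℕ} {S T : Shape k n}
    (h : shapeExponent a S T = shapeExponent a' S T) : a = a' := by
  funext r
  have := DFunLike.congr_fun h (k + (r : ℕ))
  rw [shapeExponent_apply, shapeExponent_apply, shapeExp, shapeExp] at this
  omega

/-- The weights are monomials with coefficient 1, distinct within each matrix entry. Reading off one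
coefficient of one entry gives dual functionals, which works over any commutative ring. -/
theorem linearIndependent_single :
    LinearIndependent O fun p : (Fin n → ℕ) × Shape k n × Shape k n =>
      (Matrix.single p.2.1 p.2.2 (shapeWeight O p.1 p.2.1 p.2.2) :
        Matrix (Shape k n) (Shape k n) (MvPolynomial ℤ O)) := by
  refine LinearIndependent.of_pairwise_dual_eq_zero_one _ (fun p =>
    (MvPolynomial.lcoeff O (shapeExponent p.1 p.2.1 p.2.2)).comp
      (Matrix.entryLinearMap O (MvPolynomial ℤ O) p.2.1 p.2.2)) ?_ ?_
  · rintro ⟨a, S, T⟩ ⟨a', S', T'⟩ h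
    simp only [LinearMap.comp_apply, Matrix.entryLinearMap_apply, Matrix.single_apply]
    split_ifs with h'
    · obtain ⟨rfl, rfl⟩ := h'
      rw [shapeWeight_eq_monomial, MvPolynomial.lcoeff_apply, MvPolynomial.coeff_monomial, if_neg]
      intro he
      exact h (by rw [shapeExponent_injective he])
    · simp
  · rintro ⟨a, S, T⟩
    simp only [LinearMap.comp_apply, Matrix.entryLinearMap_apply, Matrix.single_apply_same]
    rw [shapeWeight_eq_monomial, MvPolynomial.lcoeff_apply, MvPolynomial.coeff_monomial, if_pos rfl]

end Independence

/-! ### Gradings -/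

section GradedPiece

variable (O : Type*) {A C : Type*} [CommRing O] [Ring A] [Algebra O A] [Ring C] [Algebra O C]
  (H : ℤ → Set A)

theorem mem_gradedPiece {m : ℤ} {x : A} (h : x ∈ H m) : x ∈ gradedPiece O H m :=
  Submodule.subset_span ⟨[(m, x)], by simpa using h, by simp, by simp⟩

theorem one_mem_gradedPiece : (1 : A) ∈ gradedPiece O H 0 :=
  Submodule.subset_span ⟨[], by simp, by simp, by simp⟩

variable {O H}

theorem mul_mem_gradedPiece {m m' : ℤ} {x y : A} (hx : x ∈ gradedPiece O H m)
    (hy : y ∈ gradedPiece O H m') : x * y ∈ gradedPiece O H (m + m') := by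
  have := Submodule.mul_mem_mul hx hy
  rw [gradedPiece, gradedPiece, Submodule.span_mul_span] at this
  refine Submodule.span_mono ?_ this
  rintro _ ⟨_, ⟨L, hL, rfl, rfl⟩, _, ⟨L', hL', rfl, rfl⟩, rfl⟩
  refine ⟨L ++ L', fun p hp => ?_, by simp, by simp⟩
  rcases List.mem_append.1 hp with h | h
  · exact hL p h
  · exact hL' p h

variable (O H) in
/-- The submonoid of homogeneous elements. -/
def homogeneousSubmonoid : Submonoid A where
  carrier := {x | ∃ m, x ∈ gradedPiece O H m}
  one_mem' := ⟨0, one_mem_gradedPiece O H⟩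
  mul_mem' := fun ⟨m, hm⟩ ⟨m', hm'⟩ => ⟨m + m', mul_mem_gradedPiece hm hm'⟩

theorem map_mem_of_mem_gradedPiece (f : A →ₐ[O] C) (N : ℤ → Submodule O C)
    (h1 : 1 ∈ N 0) (hmul : ∀ m m' x y, x ∈ N m → y ∈ N m' → x * y ∈ N (m + m'))
    (hH : ∀ m, ∀ x ∈ H m, f x ∈ N m) {m : ℤ} {x : A} (hx : x ∈ gradedPiece O H m) : f x ∈ N m := by
  suffices h : gradedPiece O H m ≤ (N m).comap f.toLinearMap from h hx
  rw [gradedPiece, Submodule.span_le]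
  rintro _ ⟨L, hL, rfl, rfl⟩
  change f _ ∈ N _
  clear hx
  induction L with
  | nil => simpa using h1
  | cons p L ih =>
    simp only [List.map_cons, List.sum_cons, List.prod_cons, map_mul]
    exact hmul _ _ _ _ (hH _ _ (hL p List.mem_cons_self))
      (ih fun q hq => hL q (List.mem_cons_of_mem _ hq))

end GradedPiece

/-! ### Recognizing a grading by the degree of matrix entries -/

section HomMat

variable (O : Type*) [CommRing O] (ι : Type*)

/-- Matrices with entries which are homogeneous polynomials of degree `m`. -/
def homMat (m : ℤ) : Submodule O (Matrix ι ι (MvPolynomial ℤ O)) where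
  -- Every variable has weight 1 taken in `ℤ`, so that degrees lie in the index set of the gradings.
  carrier := {X | ∀ i j, MvPolynomial.IsWeightedHomogeneous (fun _ => (1 : ℤ)) (X i j) m}
  zero_mem' _ _ := MvPolynomial.isWeightedHomogeneous_zero _ _ _
  add_mem' hX hY i j := (hX i j).add (hY i j)
  smul_mem' c X hX i j := by
    rw [Matrix.smul_apply, MvPolynomial.smul_eq_C_mul]
    exact (hX i j).C_mul c

variable {O ι}

theorem one_mem_homMat [DecidableEq ι] : 1 ∈ homMat O ι 0 := by
  intro i j
  rw [Matrix.one_apply]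
  split_ifs
  · exact MvPolynomial.isWeightedHomogeneous_one _ _
  · exact MvPolynomial.isWeightedHomogeneous_zero _ _ _

theorem mul_mem_homMat [Fintype ι] (m m' : ℤ) (X Y : Matrix ι ι (MvPolynomial ℤ O))
    (hX : X ∈ homMat O ι m) (hY : Y ∈ homMat O ι m') : X * Y ∈ homMat O ι (m + m') := by
  intro i j
  rw [Matrix.mul_apply]
  exact MvPolynomial.IsWeightedHomogeneous.sum _ _ _ fun p _ => (hX i p).mul (hY p j)

variable (O ι) in
/-- The projection to the matrices with homogeneous entries of degree `m`. -/
noncomputable def homMatProj (m : ℤ) :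
    Matrix ι ι (MvPolynomial ℤ O) →ₗ[O] Matrix ι ι (MvPolynomial ℤ O) :=
  (MvPolynomial.weightedHomogeneousComponent (fun _ => (1 : ℤ)) m).mapMatrix

theorem homMatProj_same {m : ℤ} {X : Matrix ι ι (MvPolynomial ℤ O)} (h : X ∈ homMat O ι m) :
    homMatProj O ι m X = X := by
  ext1 i j
  exact (h i j).weightedHomogeneousComponent_same

theorem homMatProj_ne {m m' : ℤ} {X : Matrix ι ι (MvPolynomial ℤ O)} (h : X ∈ homMat O ι m)
    (hm : m' ≠ m) : homMatProj O ι m' X = 0 := by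
  ext1 i j
  exact (h i j).weightedHomogeneousComponent_ne m' hm

variable {V : Type*} [AddCommGroup V] [Module O V] (G : ℤ → Submodule O V)
  (Θ : V →ₗ[O] Matrix ι ι (MvPolynomial ℤ O))

theorem iSup_ne_le_ker (hG : ∀ m, ∀ x ∈ G m, Θ x ∈ homMat O ι m) (m : ℤ) :
    ⨆ j, ⨆ (_ : j ≠ m), G j ≤ ((homMatProj O ι m).comp Θ).ker :=
  iSup₂_le fun j hj x hx => homMatProj_ne (hG j x hx) hj.symm

/-- An element of one piece that is also a sum from the others is fixed, after applying `Θ`, by the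
projection to its degree and killed by it. -/
theorem isInternal_of_homMat (hΘ : Function.Injective Θ)
    (hG : ∀ m, ∀ x ∈ G m, Θ x ∈ homMat O ι m) (htop : ⨆ m, G m = ⊤) :
    DirectSum.IsInternal G := by
  rw [DirectSum.isInternal_submodule_iff_iSupIndep_and_iSup_eq_top]
  refine ⟨fun m => ?_, htop⟩
  rw [Submodule.disjoint_def]
  intro x hx hx'
  have := iSup_ne_le_ker G Θ hG m hx'
  rw [LinearMap.mem_ker, LinearMap.comp_apply, homMatProj_same (hG m x hx)] at this
  exact (map_eq_zero_iff Θ hΘ).1 this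

/-- For the converse split `x = y + z` with `y` in the piece `m` and `z` in the sum of the others.
The projection kills `Θ z`, so `Θ x = Θ y`, and faithfulness gives `x = y`. -/
theorem mem_iff_homMat (hΘ : Function.Injective Θ)
    (hG : ∀ m, ∀ x ∈ G m, Θ x ∈ homMat O ι m) (htop : ⨆ m, G m = ⊤)
    (m : ℤ) (x : V) : x ∈ G m ↔ Θ x ∈ homMat O ι m := by
  refine ⟨hG m x, fun h => ?_⟩
  have htop' : G m ⊔ ⨆ j, ⨆ (_ : j ≠ m), G j = ⊤ := by
    rw [eq_top_iff, ← htop]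
    refine iSup_le fun j => ?_
    by_cases hj : j = m
    · subst hj; exact le_sup_left
    · exact le_sup_of_le_right (le_iSup₂_of_le j hj le_rfl)
  obtain ⟨y, hy, z, hz, rfl⟩ := Submodule.mem_sup.1 (htop' ▸ Submodule.mem_top : x ∈ _)
  have hz' := iSup_ne_le_ker G Θ hG m hz
  rw [LinearMap.mem_ker, LinearMap.comp_apply] at hz'
  have h1 := homMatProj_same h
  rw [map_add, map_add, hz', homMatProj_same (hG m y hy), add_zero, ← map_add] at h1
  rw [← hΘ h1]
  exact hy

end HomMat

/-! ### Comparing algebras through spanning families with independent images -/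

theorem iSup_eq_top_of_span {O V I : Type*} [CommRing O] [AddCommGroup V] [Module O V]
    (G : ℤ → Submodule O V) {v : I → V} (hv : Submodule.span O (Set.range v) = ⊤)
    (h : ∀ i, ∃ m, v i ∈ G m) : ⨆ m, G m = ⊤ := by
  rw [eq_top_iff, ← hv, Submodule.span_le]
  rintro _ ⟨i, rfl⟩
  obtain ⟨m, hm⟩ := h i
  exact Submodule.mem_iSup_of_mem m hm

theorem injective_of_span {O V M I : Type*} [CommRing O] [AddCommGroup V] [Module O V]
    [AddCommGroup M] [Module O M] (Θ : V →ₗ[O] M) {v : I → V}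
    (hv : Submodule.span O (Set.range v) = ⊤) {w : I → M} (hw : LinearIndependent O w)
    (h : ∀ i, Θ (v i) = w i) : Function.Injective Θ := by
  rw [injective_iff_map_eq_zero]
  intro x hx
  have hx' : x ∈ Submodule.span O (Set.range v) := hv ▸ Submodule.mem_top
  obtain ⟨c, rfl⟩ := Finsupp.mem_span_range_iff_exists_finsupp.1 hx'
  have h0 : Finsupp.linearCombination O w c = 0 := by
    rw [← hx, Finsupp.linearCombination_apply, map_finsuppSum]
    simp only [map_smul, h]
  rw [linearIndependent_iff.1 hw c h0]
  simp

theorem range_eq_span {O V M I : Type*} [CommRing O] [Ring V] [Algebra O V]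
    [Ring M] [Algebra O M] (Θ : V →ₐ[O] M) {v : I → V}
    (hv : Submodule.span O (Set.range v) = ⊤) {w : I → M} (h : ∀ i, Θ (v i) = w i) :
    Subalgebra.toSubmodule Θ.range = Submodule.span O (Set.range w) := by
  have : Set.range w = Θ.toLinearMap '' Set.range v := by
    rw [← Set.range_comp]
    exact congrArg Set.range (funext fun i => (h i).symm)
  rw [this, Submodule.span_image, hv, Submodule.map_top]
  rfl

/-- Two faithful representations with the same image identify two algebras. -/
theorem exists_algEquiv_of_span {O V V' M I : Type*} [CommRing O] [Ring V] [Algebra O V]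
    [Ring V'] [Algebra O V'] [Ring M] [Algebra O M] (Θ : V →ₐ[O] M) (Θ' : V' →ₐ[O] M) {v : I → V}
    {v' : I → V'} (hv : Submodule.span O (Set.range v) = ⊤)
    (hv' : Submodule.span O (Set.range v') = ⊤) {w : I → M} (hw : LinearIndependent O w)
    (h : ∀ i, Θ (v i) = w i) (h' : ∀ i, Θ' (v' i) = w i) :
    ∃ ι : V ≃ₐ[O] V', ∀ x, Θ' (ι x) = Θ x := by
  have hinj : Function.Injective Θ := injective_of_span Θ.toLinearMap hv hw h
  have hinj' : Function.Injective Θ' := injective_of_span Θ'.toLinearMap hv' hw h'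
  have hr : Θ.range = Θ'.range := by
    exact Subalgebra.toSubmodule_injective
      ((range_eq_span Θ hv h).trans (range_eq_span Θ' hv' h').symm)
  refine ⟨((AlgEquiv.ofInjective Θ hinj).trans (Subalgebra.equivOfEq _ _ hr)).trans
    (AlgEquiv.ofInjective Θ' hinj').symm, fun x => ?_⟩
  exact congrArg Subtype.val ((AlgEquiv.ofInjective Θ' hinj').apply_symm_apply
    (Subalgebra.equivOfEq _ _ hr (AlgEquiv.ofInjective Θ hinj x)))

/-! ### The grading of `B_n` -/

section BnGrade

variable (O : Type*) [CommRing O] {k : ℤ} {n : ℕ}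

theorem Bn.e_mem_grade (σ : Fin n → Bool) : Bn.e O σ ∈ Bn.grade O n 0 :=
  mem_gradedPiece O _ (Or.inl ⟨rfl, σ, rfl⟩)

theorem Bn.b_mem_grade (r : Fin n) : Bn.b O r ∈ Bn.grade O n 1 :=
  mem_gradedPiece O _ (Or.inr ⟨rfl, r, rfl⟩)

/-- Such a tensor is a product of powers of the `b_r` times one `e(σ)`. Its degree need not be
named, since it can be read off from the matrix. -/
theorem Bn.exists_std_mem_grade (a : Fin n → ℕ) (S T : Shape k n) :
    ∃ m, Bn.std O a S T ∈ Bn.grade O n m := by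
  let N : Submonoid (Bn O n) := homogeneousSubmonoid O
    (fun c => {x | (c = 0 ∧ ∃ σ, x = Bn.e O σ) ∨ (c = 1 ∧ ∃ r, x = Bn.b O r)})
  change Bn.std O a S T ∈ N
  have h1 : Bn.std O a S T = PiTensorProduct.tprod O (fun r => B.b O ^ shapeExp a S T r) *
      Bn.e O T.sign := by
    rw [Bn.e, PiTensorProduct.tprod_mul_tprod]
    rfl
  rw [h1]
  refine mul_mem ?_ (⟨0, Bn.e_mem_grade O _⟩ : _ ∈ N)
  generalize shapeExp a S T = c
  have main : ∀ s : Finset (Fin n),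
      PiTensorProduct.tprod O (fun r => if r ∈ s then B.b O ^ c r else 1) ∈ N := by
    intro s
    induction s using Finset.induction_on with
    | empty =>
      simp only [Finset.notMem_empty, if_false]
      exact one_mem N
    | insert r s hr ih =>
      have h2 : PiTensorProduct.tprod O (fun t => if t ∈ insert r s then B.b O ^ c t else 1) =
          Bn.b O r ^ c r *
            PiTensorProduct.tprod O (fun t => if t ∈ s then B.b O ^ c t else 1) := by
        have h3 := map_pow (PiTensorProduct.tprodMonoidHom O (A := fun _ : Fin n => B O))
          (fun t => if t = r then B.b O else 1) (c r)
        have h4 : Bn.b O r ^ c r = PiTensorProduct.tprod O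
            ((fun t => if t = r then B.b O else 1) ^ c r) := h3.symm
        rw [h4, PiTensorProduct.tprod_mul_tprod]
        congr 1
        funext t
        by_cases h : t = r
        · subst h; simp [hr]
        · simp [h]
      rw [h2]
      exact mul_mem (pow_mem (⟨1, Bn.b_mem_grade O r⟩ : _ ∈ N) _) ih
  simpa using main Finset.univ

theorem Bn.iSup_grade (n : ℕ) : ⨆ m, Bn.grade O n m = ⊤ :=
  iSup_eq_top_of_span _ (Bn.span_std O 0) fun p => Bn.exists_std_mem_grade O p.1 p.2.1 p.2.2

variable (k) in
theorem Bn.rep_mem_homMat (m : ℤ) (x : Bn O n) (hx : x ∈ Bn.grade O n m) :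
    Bn.rep O k n x ∈ homMat O (Shape k n) m := by
  refine map_mem_of_mem_gradedPiece (Bn.rep O k n) (homMat O (Shape k n)) one_mem_homMat
    mul_mem_homMat ?_ hx
  rintro m x (⟨rfl, σ, rfl⟩ | ⟨rfl, r, rfl⟩) S T
  · rw [Bn.e, Bn.rep_tprod]
    rw [← Finset.sum_const_zero (s := (Finset.univ : Finset (Fin n)))]
    refine MvPolynomial.IsWeightedHomogeneous.prod _ _ _ fun t _ => ?_
    rw [B.rep_e, Matrix.single_apply]
    split_ifs
    · exact MvPolynomial.isWeightedHomogeneous_one _ _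
    · exact MvPolynomial.isWeightedHomogeneous_zero _ _ _
  · rw [Bn.b, Bn.rep_tprod]
    -- The degree 1 of an entry of `b_r` is carried by the tensor factor `r`; the remaining factors
    -- are identity matrices of degree 0.
    have h1 : ∑ t : Fin n, (if t = r then 1 else 0 : ℤ) = 1 := by simp
    convert MvPolynomial.IsWeightedHomogeneous.prod Finset.univ _
      (fun t => if t = r then (1 : ℤ) else 0) (w := fun _ => (1 : ℤ)) fun t _ => ?_ using 1
    · exact h1.symm
    by_cases h : t = r
    · rw [if_pos h, if_pos h, B.rep_b]
      simp only [bMat, Matrix.of_apply]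
      split_ifs
      · exact MvPolynomial.isWeightedHomogeneous_zero _ _ _
      · exact MvPolynomial.isWeightedHomogeneous_X O (fun _ : ℤ => (1 : ℤ)) _
    · rw [if_neg h, if_neg h, map_one, Matrix.one_apply]
      split_ifs
      · exact MvPolynomial.isWeightedHomogeneous_one _ _
      · exact MvPolynomial.isWeightedHomogeneous_zero _ _ _

variable (k n) in
theorem Bn.rep_injective : Function.Injective (Bn.rep O k n) :=
  injective_of_span (M := Matrix (Shape k n) (Shape k n) (MvPolynomial ℤ O))
    (Bn.rep O k n).toLinearMap (Bn.span_std O k) (linearIndependent_single O)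
    fun p => Bn.rep_std O p.1 p.2.1 p.2.2

variable (k) in
theorem Bn.mem_grade_iff (m : ℤ) (x : Bn O n) :
    x ∈ Bn.grade O n m ↔ Bn.rep O k n x ∈ homMat O (Shape k n) m :=
  mem_iff_homMat _ (Bn.rep O k n).toLinearMap (Bn.rep_injective O k n) (Bn.rep_mem_homMat O k)
    (Bn.iSup_grade O n) m x

theorem Bn.gradedMonoid_grade (n : ℕ) : SetLike.GradedMonoid (Bn.grade O n) where
  one_mem := one_mem_gradedPiece O _
  mul_mem _ _ _ _ hx hy := mul_mem_gradedPiece hx hy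

theorem Bn.nonempty_gradedAlgebra (n : ℕ) : Nonempty (GradedAlgebra (Bn.grade O n)) :=
  ⟨{ toGradedMonoid := Bn.gradedMonoid_grade O n
     toDecomposition := (isInternal_of_homMat _ (Bn.rep O 0 n).toLinearMap
      (Bn.rep_injective O 0 n) (Bn.rep_mem_homMat O 0) (Bn.iSup_grade O n)).chooseDecomposition }⟩

end BnGrade

/-! ### The grading of `e R'_ρ e` -/

section CornerGrade

variable (O : Type*) [CommRing O] (ε : ℤ → ℤ → ℤˣ) {α : ℤ →₀ ℕ} {d : ℕ} {k : ℤ} {n : ℕ}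

theorem KLR.idem_mem_grade (i : Word α d) : KLR.idem O ε i ∈ KLR.grade O ε α d 0 :=
  mem_gradedPiece O _ (Or.inl ⟨i, rfl, rfl⟩)

theorem KLR.y_mem_grade (r : Fin d) (i : Word α d) :
    KLR.y O ε r * KLR.idem O ε i ∈ KLR.grade O ε α d 2 :=
  mem_gradedPiece O _ (Or.inr (Or.inl ⟨i, r, by simp [cartan], rfl⟩))

theorem KLR.psi_mem_grade (r : Fin (d - 1)) (i : Word α d) :
    KLR.psi O ε r * KLR.idem O ε i ∈
      KLR.grade O ε α d (-cartan (i.letter (fst r)) (i.letter (snd r))) :=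
  mem_gradedPiece O _ (Or.inr (Or.inr ⟨i, r, rfl, rfl⟩))

/-- The degree of a crossing depends on the word it acts on, so the appropriate idempotent is
inserted before each factor. -/
theorem KLR.exists_psiList_mem_grade (L : List (Fin (d - 1))) (i : Word α d) :
    ∃ m, KLR.psiList O ε α L * KLR.idem O ε i ∈ KLR.grade O ε α d m := by
  induction L with
  | nil => exact ⟨0, by simpa [KLR.psiList] using KLR.idem_mem_grade O ε i⟩
  | cons r L ih =>
    obtain ⟨m, hm⟩ := ih
    have h := mul_mem_gradedPiece (KLR.psi_mem_grade O ε r (i.act (L.map s).prod)) hm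
    have e : KLR.psi O ε r * KLR.idem O ε (i.act (L.map s).prod) *
        (KLR.psiList O ε α L * KLR.idem O ε i) =
          KLR.psiList O ε α (r :: L) * KLR.idem O ε i := by
      rw [KLR.psiList_mul_idem, mul_assoc, ← mul_assoc (KLR.idem O ε _), KLR.idem_mul_self,
        ← KLR.psiList_mul_idem]
      simp [KLR.psiList, mul_assoc]
    exact ⟨_, e ▸ h⟩

theorem KLR.dot_mem_grade (r : Fin (n + 1)) :
    KLR.dot O ε k r ∈ KLR.grade O ε (root k (k + n)) (n + 1) 2 :=
  sum_mem fun i _ => KLR.y_mem_grade O ε _ i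

theorem KLR.z_mem_grade (r : Fin n) :
    (KLR.z O ε k r).1 ∈ KLR.grade O ε (root k (k + n)) (n + 1) 2 := by
  have := KLR.coe_z' O ε k r
  rw [this]
  exact zsmul_mem (sub_mem (KLR.dot_mem_grade O ε _) (KLR.dot_mem_grade O ε _)) _

theorem KLR.exists_zmon_mem_grade (a : Fin n → ℕ) :
    ∃ m, (KLR.zmon O ε k a).1 ∈ KLR.grade O ε (root k (k + n)) (n + 1) m := by
  let N : Submonoid (KLR O ε (root k (k + n)) (n + 1)) := homogeneousSubmonoid O
    (fun c => {x | (∃ i, c = 0 ∧ x = KLR.idem O ε i) ∨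
      (∃ i r, c = cartan (i.letter r) (i.letter r) ∧ x = KLR.y O ε r * KLR.idem O ε i) ∨
      (∃ i r, c = -cartan (i.letter (fst r)) (i.letter (snd r)) ∧
        x = KLR.psi O ε r * KLR.idem O ε i)})
  change KLR.zmon O ε k a ∈ N.comap (Subalgebra.center O _).val
  exact prod_mem fun r _ => pow_mem (⟨2, KLR.z_mem_grade O ε r⟩ : _ ∈ N) _

theorem exists_cornerElem_mem_grade (a : Fin n → ℕ) (S T : Shape k n) :
    ∃ m, cornerElem O ε a S T ∈ eRe.grade O ε k n m := by
  obtain ⟨m, hm⟩ := KLR.exists_zmon_mem_grade O ε (k := k) a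
  obtain ⟨m', hm'⟩ := KLR.exists_psiList_mem_grade O ε
    (exists_isReducedExpr (S.perm T)).choose T.word
  exact ⟨m + m', mul_mem_gradedPiece hm hm'⟩

variable {ε} (hε : ∀ i j : ℤ, |i - j| = 1 → ε i j * ε j i = -1)

theorem iSup_eRe_grade (hε : ∀ i j : ℤ, |i - j| = 1 → ε i j * ε j i = -1) :
    ⨆ m, eRe.grade O ε k n m = ⊤ :=
  iSup_eq_top_of_span _ (span_cornerElem O ε hε) fun p =>
    exists_cornerElem_mem_grade O ε p.1 p.2.1 p.2.2

theorem dotWeight_isHomogeneous (c : ℤ) :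
    MvPolynomial.IsWeightedHomogeneous (fun _ => (1 : ℤ)) (dotWeight O ε k c) 2 := by
  rw [← MvPolynomial.mem_weightedHomogeneousSubmodule, dotWeight]
  refine neg_mem (sum_mem fun t _ => zsmul_mem ?_ _)
  rw [MvPolynomial.mem_weightedHomogeneousSubmodule]
  simpa using (MvPolynomial.isWeightedHomogeneous_X O (fun _ => (1 : ℤ)) (k + (t : ℤ))).pow 2

/-- The square root `X` has degree 1, which is the KLR degree of a crossing of neighbouring colours;
distant colours cross in degree 0. -/
theorem crossWeight_isHomogeneous {a b : ℤ} (h : a ≠ b) :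
    MvPolynomial.IsWeightedHomogeneous (fun _ => (1 : ℤ)) (crossWeight O a b) (-cartan a b) := by
  rw [crossWeight, cartan, if_neg h]
  split_ifs
  · simpa using MvPolynomial.isWeightedHomogeneous_X O (fun _ => (1 : ℤ)) (min a b)
  · simpa using MvPolynomial.isWeightedHomogeneous_one O (fun _ : ℤ => (1 : ℤ))

theorem matRep_mem_homMat (m : ℤ) (x : KLR O ε (root k (k + n)) (n + 1))
    (hx : x ∈ KLR.grade O ε _ _ m) : matRep O hε x ∈ homMat O (RootWord k n) m := by
  classical
  refine map_mem_of_mem_gradedPiece (matRep O hε) (homMat O _) one_mem_homMat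
    mul_mem_homMat ?_ hx
  have hsingle : ∀ p q : RootWord k n, MvPolynomial.IsWeightedHomogeneous (fun _ => (1 : ℤ))
      ((Pi.single p 1 : PolySpace O k n) q) 0 := by
    intro p q
    rw [Pi.single_apply]
    split_ifs
    · exact MvPolynomial.isWeightedHomogeneous_one _ _
    · exact MvPolynomial.isWeightedHomogeneous_zero _ _ _
  rintro m x (⟨i, rfl, rfl⟩ | ⟨i, r, rfl, rfl⟩ | ⟨i, r, rfl, rfl⟩) p q
  · rw [matRep_idem]
    split_ifs
    · exact MvPolynomial.isWeightedHomogeneous_one _ _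
    · exact MvPolynomial.isWeightedHomogeneous_zero _ _ _
  · rw [matRep_apply, map_mul, Module.End.mul_apply, polyRep_y, polyRep_idem, opY_apply,
      opIdem_apply]
    split_ifs with h
    · have := (dotWeight_isHomogeneous O (ε := ε) (k := k) (p.letter r)).mul (hsingle q p)
      convert this using 1
      simp [cartan]
    · rw [mul_zero]
      exact MvPolynomial.isWeightedHomogeneous_zero _ _ _
  · rw [matRep_apply, map_mul, Module.End.mul_apply, polyRep_psi, polyRep_idem, opPsi_apply,
      opIdem_apply]
    split_ifs with h
    · subst h
      -- The operator weights a crossing by the word after it, while the degree of `ψ_r 1_i` uses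
      -- the word before it; the two letters are interchanged.
      rw [crossWeight_comm]
      have := (crossWeight_isHomogeneous O ((p.act (s r)).letter_fst_ne r)).mul
        (hsingle q (p.act (s r)))
      rw [add_zero] at this
      simp only [Word.letter_act, s_inv, s_fst, s_snd] at this ⊢
      convert this
    · rw [mul_zero]
      exact MvPolynomial.isWeightedHomogeneous_zero _ _ _

theorem cornerRep_mem_homMat (m : ℤ) (x : eRe O ε k n) (hx : x ∈ eRe.grade O ε k n m) :
    cornerRep hε x ∈ homMat O (Shape k n) m :=
  fun S T => matRep_mem_homMat O hε m _ hx S.word T.word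

theorem cornerRep_injective : Function.Injective (cornerRep (O := O) (k := k) (n := n) hε) :=
  injective_of_span (M := Matrix (Shape k n) (Shape k n) (MvPolynomial ℤ O))
    (cornerRep hε).toLinearMap (span_cornerElem O ε hε)
    (linearIndependent_single O) fun p => cornerRep_cornerElem O ε hε p.1 p.2.1 p.2.2

theorem mem_eRe_grade_iff (m : ℤ) (x : eRe O ε k n) :
    x ∈ eRe.grade O ε k n m ↔ cornerRep hε x ∈ homMat O (Shape k n) m :=
  mem_iff_homMat _ (cornerRep hε).toLinearMap (cornerRep_injective O hε)
    (cornerRep_mem_homMat O hε) (iSup_eRe_grade O hε) m x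

variable (ε) in
theorem gradedMonoid_eRe_grade : SetLike.GradedMonoid (eRe.grade O ε k n) where
  one_mem := by
    change eRe.incl O ε k n 1 ∈ KLR.grade O ε _ _ 0
    rw [incl_one]
    exact sum_mem fun S _ => KLR.idem_mem_grade O ε _
  mul_mem m m' x y hx hy := by
    change eRe.incl O ε k n x ∈ KLR.grade O ε _ _ m at hx
    change eRe.incl O ε k n y ∈ KLR.grade O ε _ _ m' at hy
    change eRe.incl O ε k n (x * y) ∈ KLR.grade O ε _ _ (m + m')
    rw [incl_mul]
    exact mul_mem_gradedPiece hx hy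

theorem eRe.nonempty_gradedAlgebra (hε : ∀ i j : ℤ, |i - j| = 1 → ε i j * ε j i = -1) :
    Nonempty (GradedAlgebra (eRe.grade O ε k n)) :=
  ⟨{ toGradedMonoid := gradedMonoid_eRe_grade O ε
     toDecomposition := (isInternal_of_homMat _ (cornerRep hε).toLinearMap
      (cornerRep_injective O hε) (cornerRep_mem_homMat O hε)
      (iSup_eRe_grade O hε)).chooseDecomposition }⟩

theorem incl_cornerElem_zero (S T : Shape k n) :
    eRe.incl O ε k n (cornerElem O ε 0 S T) = psiShape O ε S T * KLR.idem O ε T.word := by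
  rw [incl_cornerElem, KLR.stdElem, KLR.zmon, psiShape]
  simp

theorem psiShape_self (S : Shape k n) : psiShape O ε S S = 1 := by
  rw [psiShape, Shape.perm_eq (Word.act_one _), KLR.psiPerm_one]

end CornerGrade

end KLRTypeA

/-! ### The graded isomorphism -/

open KLRTypeA in
theorem mainTheorem3 {O : Type*} [CommRing O] (ε : ℤ → ℤ → ℤˣ)
    (hε : ∀ i j : ℤ, |i - j| = 1 → ε i j * ε j i = -1) (k : ℤ) (n : ℕ) :
    (∀ (w : Equiv.Perm (Fin (n + 1))) (L : List (Fin (n + 1 - 1))), IsReducedExpr L w →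
      KLR.psiList O ε (root k (k + n)) L = KLR.psiPerm O ε (root k (k + n)) w) ∧
    Nonempty (GradedAlgebra (Bn.grade O n)) ∧
    Nonempty (GradedAlgebra (eRe.grade O ε k n)) ∧
    ∃ ι : Bn O n ≃ₐ[O] eRe O ε k n,
      (∀ m : ℤ, (Bn.grade O n m).map ι.toLinearMap = eRe.grade O ε k n m) ∧
      (∀ S : Shape k n, eRe.incl O ε k n (ι (Bn.e O S.sign)) = KLR.idem O ε S.word) ∧
      ∀ (S : Shape k n) (r : Fin n),
        eRe.incl O ε k n (ι (Bn.b O r * Bn.e O S.sign)) =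
          psiShape O ε (S.sp r) S * KLR.idem O ε S.word := by
  refine ⟨fun w L h => KLR.psiList_eq_psiPerm O ε h, Bn.nonempty_gradedAlgebra O n,
    eRe.nonempty_gradedAlgebra O hε, ?_⟩
  obtain ⟨ι, hι⟩ := exists_algEquiv_of_span (Bn.rep O k n) (cornerRep hε) (Bn.span_std O k)
    (span_cornerElem O ε hε) (linearIndependent_single O)
    (fun p => Bn.rep_std O p.1 p.2.1 p.2.2) fun p => cornerRep_cornerElem O ε hε p.1 p.2.1 p.2.2
  -- Both sides have the same weighted matrix unit as image, and the corner is represented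
  -- faithfully. The prescribed generators are the case `a = 0`, with `S = T` or `S = sp_r T`.
  have hstd : ∀ a S T, ι (Bn.std O a S T) = cornerElem O ε a S T := fun a S T =>
    cornerRep_injective O hε (by rw [hι, Bn.rep_std, cornerRep_cornerElem])
  refine ⟨ι, fun m => ?_, fun S => ?_, fun S r => ?_⟩
  · ext x
    rw [mem_eRe_grade_iff O hε]
    constructor
    · rintro ⟨y, hy, rfl⟩
      change cornerRep hε (ι y) ∈ _
      rw [hι]
      exact Bn.rep_mem_homMat O k m y hy
    · intro hx
      refine ⟨ι.symm x, ?_, ι.apply_symm_apply x⟩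
      change ι.symm x ∈ Bn.grade O n m
      rwa [Bn.mem_grade_iff O k, ← hι, ι.apply_symm_apply]
  · rw [← Bn.std_self, hstd, incl_cornerElem_zero, psiShape_self, one_mul]
  · rw [← Bn.std_sp, hstd, incl_cornerElem_zero]
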